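/- All graphs are finite, simple and undirected, and networks are connected graphs. A graph $G$ is *2-connected* if it is connected and has no cut-vertex, i.e. no vertex $v$ such that $G\setminus\{v\}$ contains two vertices not joined by a path (a single edge is thus 2-connected). A *two-terminal series-parallel graph* is a graph with a source and a sink built recursively as follows: a single edge is series-parallel, its endpoints being the source and the sink; the series composition of two series-parallel graphs (identify the sink of the first with the source of the second) and their parallel composition (identify the two sources, and identify the two sinks) are series-parallel. A (simple) graph is *series-parallel* if it is a two-terminal series-parallel graph for some choice of source and sink. Fix $k\in\mathbb N$. In a network $G$ with $n$ vertices, the vertices carry pairwise distinct identifiers from $\{1,\dots,n^k\}$. A *certificate assignment* gives each vertex a finite bit string. A *verifier* is a function (the same for all networks) that maps the local view of a vertex $v$, namely the identifier and certificate of $v$ together with the set of the pairs (identifier, certificate) of the neighbours of $v$, to accept or reject. A class $\mathcal C$ of graphs *can be certified with $f(n)$-bit labels* if there is a verifier such that, for every connected graph $G$ with $n$ vertices and every such assignment of identifiers: if $G\in\mathcal C$, there is a certificate assignment with certificates of length at most $f(n)$ for which all vertices accept; if $G\notin\mathcal C$, then for every certificate assignment (of any length) at least one vertex rejects. **Theorem.**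 For every $k\in\mathbb N$ there is a function $f:\mathbb N\to\mathbb N$ with $f(n)=O(\log n)$ such that the class of 2-connected series-parallel graphs can be certified with $f(n)$-bit labels. -/

import Mathlib

/-! ### Two-terminal series-parallel graphs and 2-connectivity -/

namespace LocalCert

/-- `IsTwoTerminalSP G H s t`: the subgraph `H` of `G` is a two-terminal series-parallel graph with
source `s` and sink `t`.  The gluing operations are expressed inside the ambient graph `G`: the two
parts are subgraphs of `G` that share exactly the identified vertices.  All graphs are simple, so in
a parallel composition the two parts have no common edge (no edge is doubled). -/
inductive IsTwoTerminalSP {V : Type*} (G : SimpleGraph V) : G.Subgraph → V → V → Prop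
  | edge {s t : V} (h : G.Adj s t) : IsTwoTerminalSP G (G.subgraphOfAdj h) s t
  | series {H₁ H₂ : G.Subgraph} {s m t : V}
      (h₁ : IsTwoTerminalSP G H₁ s m) (h₂ : IsTwoTerminalSP G H₂ m t)
      (hverts : H₁.verts ∩ H₂.verts = {m}) :
      IsTwoTerminalSP G (H₁ ⊔ H₂) s t
  | parallel {H₁ H₂ : G.Subgraph} {s t : V}
      (h₁ : IsTwoTerminalSP G H₁ s t) (h₂ : IsTwoTerminalSP G H₂ s t)
      (hverts : H₁.verts ∩ H₂.verts = {s, t})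
      (hedges : Disjoint H₁.edgeSet H₂.edgeSet) :
      IsTwoTerminalSP G (H₁ ⊔ H₂) s t

/-- A graph is series-parallel if it is a two-terminal series-parallel graph for some choice of the
source and the sink. -/
def IsSeriesParallel {V : Type*} (G : SimpleGraph V) : Prop :=
  ∃ s t : V, IsTwoTerminalSP G ⊤ s t

/-- Removing `v` leaves two vertices that are not joined by a path. -/
def IsCutVertex {V : Type*} (G : SimpleGraph V) (v : V) : Prop :=
  ¬ (G.induce ({v}ᶜ : Set V)).Preconnected

/-- A connected graph without cut-vertex (a single edge is allowed). -/
def IsTwoConnected {V : Type*} (G : SimpleGraph V) : Prop :=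
  G.Connected ∧ ∀ v : V, ¬ IsCutVertex G v

/-! ### Local certification at distance one (proof-labeling schemes) -/

/-- A class of graphs. -/
abbrev GraphClass := (V : Type) → SimpleGraph V → Prop

/-- What a node sees: its own identifier and certificate, and the set of the pairs
(identifier, certificate) of its neighbours. -/
structure LocalView where
  ident : ℕ
  cert : List Bool
  nbrs : Set (ℕ × List Bool)

/-- The view of the node `v` in `G` under the identifiers `ident` and the certificates `c`. -/
def localView {V : Type} (G : SimpleGraph V) (ident : V → ℕ) (c : V → List Bool) (v : V) :
    LocalView where
  ident := ident v
  cert := c v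
  nbrs := (fun w => (ident w, c w)) '' G.neighborSet v

/-- A verifier decides, from the view of a node only, whether that node accepts. -/
abbrev Verifier := LocalView → Bool

/-- All nodes accept. -/
def Verifier.Accepts (A : Verifier) {V : Type} (G : SimpleGraph V) (ident : V → ℕ)
    (c : V → List Bool) : Prop :=
  ∀ v : V, A (localView G ident c v) = true

/-- Identifiers are pairwise distinct and lie in the range `[1, n ^ k]`, `n` being the number of
nodes. -/
def IsIdentifierAssignment (k : ℕ) {V : Type} [Fintype V] (ident : V → ℕ) : Prop :=
  Function.Injective ident ∧ ∀ v : V, 1 ≤ ident v ∧ ident v ≤ Fintype.card V ^ k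

/-- `CertifiableWith k C f`: when networks are connected graphs with identifiers in `[1, n ^ k]`,
the class `C` can be certified with labels on the nodes of at most `f n` bits.  The bound on the
size concerns the graphs of `C`; on the other connected graphs, certificates of all sizes have to be
rejected by some node. -/
def CertifiableWith (k : ℕ) (C : GraphClass) (f : ℕ → ℕ) : Prop :=
  ∃ A : Verifier, ∀ (V : Type) [Fintype V] (G : SimpleGraph V), G.Connected →
    ∀ ident : V → ℕ, IsIdentifierAssignment k ident →
      (C V G → ∃ c : V → List Bool,
        (∀ v : V, (c v).length ≤ f (Fintype.card V)) ∧ A.Accepts G ident c) ∧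
      (¬ C V G → ∀ c : V → List Bool, ¬ A.Accepts G ident c)

/-- The class of 2-connected series-parallel graphs. -/
def twoConnectedSeriesParallel : GraphClass :=
  fun _ G => IsTwoConnected G ∧ IsSeriesParallel G

end LocalCert

/-!
Every inner vertex of a two-terminal series-parallel graph is the middle of exactly one series
composition, whose terminals and nesting depth form its label.  Conditions that compare the label
of a vertex with those of its neighbours and of its parent, the deeper of its two terminals,
characterise the labellings that arise in this way, and 2-connectivity means that the terminals of
the whole graph are adjacent or are those of at least two labels.

A parent need not be a neighbour, so its label is forwarded along connected sets of vertices; upper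
bounds on distances that decrease towards the origin exclude forged labels.  It suffices that every
vertex holds a bounded number of labels of `O(log n)` bits: an edge or a parallel composition has
two links between its terminals along which nothing else has been forwarded, series compositions
can be reassociated so that the first part is of this kind, and then one of its links forwards the
label of the source to the middle while the other one stays free.
-/

namespace LocalCert

open Relation SimpleGraph

variable {V : Type*} {G : SimpleGraph V}

/-! ### Two-terminal series-parallel subgraphs -/

theorem disjoint_edgeSet_of_verts_inter_subset {H₁ H₂ : G.Subgraph} {u v : V}
    (hverts : H₁.verts ∩ H₂.verts ⊆ {u, v}) (hadj : ¬ H₂.Adj u v) :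
    Disjoint H₁.edgeSet H₂.edgeSet := by
  rw [Set.disjoint_left]
  rintro ⟨p, q⟩ h₁ h₂
  change H₁.Adj p q at h₁
  change H₂.Adj p q at h₂
  rcases hverts ⟨h₁.fst_mem, h₂.fst_mem⟩ with rfl | rfl <;>
    rcases hverts ⟨h₁.snd_mem, h₂.snd_mem⟩ with rfl | rfl
  · exact h₁.ne rfl
  · exact hadj h₂
  · exact hadj h₂.symm
  · exact h₁.ne rfl

theorem induce_pair_le {H K : G.Subgraph} {u v : V} (huv : ¬ H.Adj u v) (hu : u ∈ K.verts)
    (hv : v ∈ K.verts) : H.induce {u, v} ≤ K := by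
  refine ⟨Set.insert_subset hu (Set.singleton_subset_iff.2 hv), ?_⟩
  rintro p q ⟨rfl | rfl, rfl | rfl, h⟩
  exacts [(h.ne rfl).elim, (huv h).elim, (huv h.symm).elim, (h.ne rfl).elim]

namespace IsTwoTerminalSP

variable {H : G.Subgraph} {s t u v : V}

theorem source_mem (h : IsTwoTerminalSP G H s t) : s ∈ H.verts := by
  induction h with
  | edge h => simp
  | series _ _ _ ih _ => exact Or.inl ih
  | parallel _ _ _ _ ih _ => exact Or.inl ih

theorem symm (h : IsTwoTerminalSP G H s t) : IsTwoTerminalSP G H t s := by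
  induction h with
  | edge h => exact subgraphOfAdj_symm h ▸ .edge h.symm
  | series _ _ hverts ih₁ ih₂ =>
    rw [sup_comm]
    exact .series ih₂ ih₁ (by rwa [Set.inter_comm])
  | parallel _ _ hverts hedges ih₁ ih₂ =>
    exact .parallel ih₁ ih₂ (by rwa [Set.pair_comm]) hedges

theorem sink_mem (h : IsTwoTerminalSP G H s t) : t ∈ H.verts := h.symm.source_mem

theorem ne (h : IsTwoTerminalSP G H s t) : s ≠ t := by
  induction h with
  | edge h => exact h.ne
  | series h₁ h₂ hverts ih₁ _ =>
    rintro rfl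
    exact ih₁ (hverts.subset ⟨h₁.source_mem, h₂.sink_mem⟩)
  | parallel _ _ _ _ ih _ => exact ih

theorem connected (h : IsTwoTerminalSP G H s t) : H.Connected := by
  induction h with
  | edge h => exact Subgraph.subgraphOfAdj_connected h
  | series h₁ h₂ _ ih₁ ih₂ =>
    exact Subgraph.connected_sup ih₁.preconnected ih₂.preconnected ⟨_, h₁.sink_mem, h₂.source_mem⟩
  | parallel h₁ h₂ _ _ ih₁ ih₂ =>
    exact Subgraph.connected_sup ih₁.preconnected ih₂.preconnected
      ⟨_, h₁.source_mem, h₂.source_mem⟩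

theorem sup_of_inter_subset {H₁ H₂ : G.Subgraph} (h₁ : IsTwoTerminalSP G H₁ u v)
    (h₂ : IsTwoTerminalSP G H₂ u v) (hverts : H₁.verts ∩ H₂.verts ⊆ {u, v})
    (hadj : ¬ H₂.Adj u v) : IsTwoTerminalSP G (H₁ ⊔ H₂) u v := by
  refine .parallel h₁ h₂ (hverts.antisymm ?_) (disjoint_edgeSet_of_verts_inter_subset hverts hadj)
  rintro x (rfl | rfl)
  · exact ⟨h₁.source_mem, h₂.source_mem⟩
  · exact ⟨h₁.sink_mem, h₂.sink_mem⟩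

theorem sup_biSup {ι : Type*} {Y : Set ι} (hY : Y.Finite) {C : ι → G.Subgraph}
    (hH : IsTwoTerminalSP G H u v) (hC : ∀ y ∈ Y, IsTwoTerminalSP G (C y) u v)
    (hadj : ∀ y ∈ Y, ¬ (C y).Adj u v) (hHC : ∀ y ∈ Y, H.verts ∩ (C y).verts ⊆ {u, v})
    (hCC : Y.Pairwise fun y z => (C y).verts ∩ (C z).verts ⊆ {u, v}) :
    IsTwoTerminalSP G (H ⊔ ⨆ y ∈ Y, C y) u v := by
  induction Y, hY using Set.Finite.induction_on generalizing H with
  | empty => simpa using hH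
  | @insert z Y hz _ ih =>
    rw [iSup_insert, ← sup_assoc]
    have hmem : ∀ y ∈ Y, y ∈ insert z Y := fun _ => Set.mem_insert_of_mem z
    refine ih (hH.sup_of_inter_subset (hC z (.inl rfl)) (hHC z (.inl rfl)) (hadj z (.inl rfl)))
      (fun y hy => hC y (hmem y hy)) (fun y hy => hadj y (hmem y hy)) (fun y hy => ?_)
      (hCC.mono (Set.subset_insert z Y))
    rw [Subgraph.verts_sup, Set.union_inter_distrib_right]
    exact Set.union_subset (hHC y (hmem y hy))
      (hCC (.inl rfl) (hmem y hy) (ne_of_mem_of_not_mem hy hz).symm)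

theorem induce_sup_biSup {ι : Type*} {Y : Set ι} (hY : Y.Finite) {C : ι → G.Subgraph}
    (hne : H.Adj u v ∨ Y.Nonempty) (hC : ∀ y ∈ Y, IsTwoTerminalSP G (C y) u v)
    (hadj : ∀ y ∈ Y, ¬ (C y).Adj u v)
    (hCC : Y.Pairwise fun y z => (C y).verts ∩ (C z).verts ⊆ {u, v}) :
    IsTwoTerminalSP G (H.induce {u, v} ⊔ ⨆ y ∈ Y, C y) u v := by
  by_cases huv : H.Adj u v
  · have hedge : H.induce {u, v} = G.subgraphOfAdj huv.adj_sub := by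
      refine le_antisymm ?_ (subgraphOfAdj_le_of_adj _ ?_)
      · refine ⟨subset_rfl, ?_⟩
        rintro p q ⟨rfl | rfl, rfl | rfl, h⟩
        exacts [(h.ne rfl).elim, rfl, Sym2.eq_swap, (h.ne rfl).elim]
      · exact ⟨.inl rfl, .inr rfl, huv⟩
    rw [hedge]
    exact (IsTwoTerminalSP.edge huv.adj_sub).sup_biSup hY hC hadj
      (fun _ _ => Set.inter_subset_left) hCC
  · obtain ⟨z, hz⟩ := hne.resolve_left huv
    have hle : H.induce {u, v} ≤ C z :=
      induce_pair_le huv (hC z hz).source_mem (hC z hz).sink_mem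
    have herase : insert z (Y \ {z}) = Y := by
      rw [Set.insert_sdiff_singleton, Set.insert_eq_of_mem hz]
    rw [sup_eq_right.2 (hle.trans (le_biSup C hz)), ← herase, iSup_insert]
    exact (hC z hz).sup_biSup hY.sdiff (fun y hy => hC y hy.1) (fun y hy => hadj y hy.1)
      (fun y hy => hCC hz hy.1 (Ne.symm hy.2)) (hCC.mono Set.sdiff_subset)

end IsTwoTerminalSP

/-! ### Connected subgraphs and 2-connectivity -/

theorem reachable_induce_of_connected {S : Set V} {P : G.Subgraph} (hP : P.Connected)
    (hPS : P.verts ⊆ S) {x y : V} (hx : x ∈ P.verts) (hy : y ∈ P.verts) :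
    (G.induce S).Reachable ⟨x, hPS hx⟩ ⟨y, hPS hy⟩ :=
  (hP.preconnected ⟨x, hx⟩ ⟨y, hy⟩).map
    ⟨fun z : P.verts => (⟨z, hPS z.2⟩ : S), fun h => P.adj_sub h⟩

namespace IsTwoTerminalSP

variable {H H₁ H₂ : G.Subgraph} {s m t c x : V}

theorem exists_connected_terminal_of_left (h₁ : IsTwoTerminalSP G H₁ s m)
    (h₂ : IsTwoTerminalSP G H₂ m t) (hverts : H₁.verts ∩ H₂.verts = {m}) {P : G.Subgraph}
    (hP : P ≤ H₁) (hPc : P.Connected) (hcP : c ∉ P.verts) (hxP : x ∈ P.verts)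
    (hsm : s ∈ P.verts ∨ m ∈ P.verts) :
    ∃ P ≤ H₁ ⊔ H₂, P.Connected ∧ c ∉ P.verts ∧ x ∈ P.verts ∧ (s ∈ P.verts ∨ t ∈ P.verts) := by
  rcases hsm with hs | hm
  · exact ⟨P, hP.trans le_sup_left, hPc, hcP, hxP, .inl hs⟩
  by_cases hc : c ∈ H₂.verts
  · refine ⟨H₁, le_sup_left, h₁.connected, fun hc₁ => hcP ?_, hP.1 hxP, .inl h₁.source_mem⟩
    exact hverts.subset ⟨hc₁, hc⟩ ▸ hm
  · exact ⟨P ⊔ H₂, sup_le_sup_right hP H₂,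
      Subgraph.connected_sup hPc.preconnected h₂.connected.preconnected ⟨m, hm, h₂.source_mem⟩,
      fun h => h.elim hcP hc, .inl hxP, .inr (.inr h₂.sink_mem)⟩

theorem exists_connected_terminal (h : IsTwoTerminalSP G H s t) (hx : x ∈ H.verts) (hxc : x ≠ c) :
    ∃ P ≤ H, P.Connected ∧ c ∉ P.verts ∧ x ∈ P.verts ∧ (s ∈ P.verts ∨ t ∈ P.verts) := by
  induction h with
  | edge h =>
    refine ⟨G.singletonSubgraph x, (singletonSubgraph_le_iff _ _).2 hx,
      Subgraph.singletonSubgraph_connected, hxc.symm, rfl, ?_⟩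
    exact hx.imp Eq.symm Eq.symm
  | series h₁ h₂ hverts ih₁ ih₂ =>
    rcases hx with hx | hx
    · obtain ⟨P, hP, hPc, hcP, hxP, hterm⟩ := ih₁ hx
      exact exists_connected_terminal_of_left h₁ h₂ hverts hP hPc hcP hxP hterm
    · obtain ⟨P, hP, hPc, hcP, hxP, hterm⟩ := ih₂ hx
      rw [Set.inter_comm] at hverts
      obtain ⟨Q, hQ, hQc, hcQ, hxQ, htermQ⟩ :=
        exists_connected_terminal_of_left h₂.symm h₁.symm hverts hP hPc hcP hxP hterm.symm
      exact ⟨Q, hQ.trans_eq (sup_comm _ _), hQc, hcQ, hxQ, htermQ.symm⟩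
  | parallel _ _ _ _ ih₁ ih₂ =>
    rcases hx with hx | hx
    · obtain ⟨P, hP, h⟩ := ih₁ hx
      exact ⟨P, hP.trans le_sup_left, h⟩
    · obtain ⟨P, hP, h⟩ := ih₂ hx
      exact ⟨P, hP.trans le_sup_right, h⟩

theorem isTwoConnected (h : IsTwoTerminalSP G ⊤ s t)
    (hst : ∀ c, c ≠ s → c ≠ t →
      ∃ P : G.Subgraph, P.Connected ∧ c ∉ P.verts ∧ s ∈ P.verts ∧ t ∈ P.verts) :
    IsTwoConnected G := by
  refine ⟨Subgraph.topIso.connected_iff.1 h.connected.coe, fun c hc => hc ?_⟩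
  have hreach {P : G.Subgraph} (hP : P.Connected) (hcP : c ∉ P.verts) {x y : V}
      (hx : x ∈ P.verts) (hy : y ∈ P.verts) :=
    reachable_induce_of_connected hP (Set.subset_compl_singleton_iff.2 hcP) hx hy
  rintro ⟨x, hx⟩ ⟨y, hy⟩
  obtain ⟨P, -, hP, hcP, hxP, hPst⟩ := h.exists_connected_terminal (Set.mem_univ x) hx
  obtain ⟨Q, -, hQ, hcQ, hyQ, hQst⟩ := h.exists_connected_terminal (Set.mem_univ y) hy
  by_cases hmeet : (P ⊓ Q).verts.Nonempty
  · exact hreach (Subgraph.connected_sup hP.preconnected hQ.preconnected hmeet)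
      (fun h => h.elim hcP hcQ) (.inl hxP) (.inr hyQ)
  have hdisj : ∀ z ∈ P.verts, z ∉ Q.verts := fun z hzP hzQ => hmeet ⟨z, hzP, hzQ⟩
  obtain ⟨hcs, hct⟩ : c ≠ s ∧ c ≠ t := by
    rcases hPst with hs | ht <;> rcases hQst with hs' | ht'
    · exact (hdisj s hs hs').elim
    · exact ⟨(ne_of_mem_of_not_mem hs hcP).symm, (ne_of_mem_of_not_mem ht' hcQ).symm⟩
    · exact ⟨(ne_of_mem_of_not_mem hs' hcQ).symm, (ne_of_mem_of_not_mem ht hcP).symm⟩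
    · exact (hdisj t ht ht').elim
  obtain ⟨R, hR, hcR, hsR, htR⟩ := hst c hcs hct
  have hRmem {S : G.Subgraph} (hS : s ∈ S.verts ∨ t ∈ S.verts) : ∃ z ∈ S.verts, z ∈ R.verts :=
    hS.elim (fun h => ⟨s, h, hsR⟩) (fun h => ⟨t, h, htR⟩)
  obtain ⟨p, hpP, hpR⟩ := hRmem hPst
  obtain ⟨q, hqQ, hqR⟩ := hRmem hQst
  exact (hreach hP hcP hxP hpP).trans ((hreach hR hcR hpR hqR).trans (hreach hQ hcQ hqQ hyQ))

end IsTwoTerminalSP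

theorem isCutVertex_of_sup_eq_top {H₁ H₂ : G.Subgraph} {s m t : V} (htop : H₁ ⊔ H₂ = ⊤)
    (hverts : H₁.verts ∩ H₂.verts = {m}) (hs : s ∈ H₁.verts) (hsm : s ≠ m) (ht : t ∈ H₂.verts)
    (htm : t ≠ m) : IsCutVertex G m := by
  intro hconn
  obtain ⟨p⟩ := hconn ⟨s, hsm⟩ ⟨t, htm⟩
  obtain ⟨⟨⟨⟨a, ha⟩, ⟨b, hb⟩⟩, hab⟩, -, haH, hbH⟩ :=
    p.exists_boundary_dart {z | (z : V) ∈ H₁.verts} hs fun h => htm (hverts.subset ⟨h, ht⟩)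
  have hadj : (H₁ ⊔ H₂).Adj a b := htop ▸ hab
  rcases hadj with h | h
  · exact hbH h.snd_mem
  · exact ha (hverts.subset ⟨haH, h.fst_mem⟩)

/-! ### Decompositions into series pairs -/

/-- The vertices of `H` other than the two terminals. -/
def innerVerts (H : G.Subgraph) (s t : V) : Set V := H.verts \ {s, t}

theorem innerVerts_comm (H : G.Subgraph) (s t : V) : innerVerts H s t = innerVerts H t s := by
  rw [innerVerts, innerVerts, Set.pair_comm]

/-- A candidate decomposition tree of a two-terminal series-parallel graph.  Every inner vertex `x`
is the middle of exactly one series composition; its terminals are `left x` and `right x`.  The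
series composition of `x` lies directly inside one of the two parts of the series composition of
`parent x`, unless its terminals are those of the whole graph.  All values at other vertices are
meaningless. -/
structure Decomposition (V : Type*) where
  left : V → V
  right : V → V
  parent : V → V
  depth : V → ℕ

namespace Decomposition

/-- The decomposition of the same graph with source and sink exchanged. -/
def swap (D : Decomposition V) : Decomposition V where
  left := D.right
  right := D.left
  parent := D.parent
  depth := D.depth

/-- The inner vertices whose series composition has the terminals `u` and `v`. -/
def middles (D : Decomposition V) (H : G.Subgraph) (s t u v : V) : Set V :=
  {x ∈ innerVerts H s t | D.left x = u ∧ D.right x = v}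

/-- `x` is the middle of a series composition directly inside one of the two parts, with terminals
`left p`, `p` and `p`, `right p`, of the series composition of `p`. -/
structure IsChild (D : Decomposition V) (H : G.Subgraph) (s t x p : V) : Prop where
  inner : x ∈ innerVerts H s t
  inner_parent : p ∈ innerVerts H s t
  parent_eq : D.parent x = p
  depth_lt : D.depth p < D.depth x
  pair : (D.left x = D.left p ∧ D.right x = p) ∨ (D.left x = p ∧ D.right x = D.right p)

/-- An edge leads from `x` into a part with sink `x`: it goes to the source `a` of that part or
to a vertex whose series composition lies in that part and ends at `x`. -/
def LinkedLeft (D : Decomposition V) (H : G.Subgraph) (s t x a : V) : Prop :=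
  ∃ y, H.Adj x y ∧ (y = a ∨ (y ∈ innerVerts H s t ∧ D.right y = x))

/-- The mirror image of `LinkedLeft`. -/
def LinkedRight (D : Decomposition V) (H : G.Subgraph) (s t x b : V) : Prop :=
  ∃ y, H.Adj x y ∧ (y = b ∨ (y ∈ innerVerts H s t ∧ D.left y = x))

/-- `u` is a terminal of the series composition of the inner vertex `v`. -/
def IsEnd (D : Decomposition V) (H : G.Subgraph) (s t u v : V) : Prop :=
  v ∈ innerVerts H s t ∧ (u = D.left v ∨ u = D.right v)

/-- `D` is a decomposition tree of `H` with source `s` and sink `t`.  Every condition but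
connectedness only relates a vertex to its neighbours and to its parent. -/
structure Describes (D : Decomposition V) (H : G.Subgraph) (s t : V) : Prop where
  ne : s ≠ t
  connected : H.Connected
  source_mem : s ∈ H.verts
  sink_mem : t ∈ H.verts
  root_or_child : ∀ x ∈ innerVerts H s t,
    x ∈ D.middles H s t s t ∨ D.IsChild H s t x (D.parent x)
  edge : ∀ u v, H.Adj u v →
    (u = s ∧ v = t) ∨ (u = t ∧ v = s) ∨ D.IsEnd H s t u v ∨ D.IsEnd H s t v u
  left : ∀ x ∈ innerVerts H s t, D.LinkedLeft H s t x (D.left x)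
  right : ∀ x ∈ innerVerts H s t, D.LinkedRight H s t x (D.right x)

variable {D : Decomposition V} {H : G.Subgraph} {s t u v x y z p : V}

theorem middles_swap : D.swap.middles H t s v u = D.middles H s t u v := by
  simp only [middles, swap, innerVerts_comm H t s, and_comm]

theorem IsChild.swap (h : D.IsChild H s t x p) : D.swap.IsChild H t s x p where
  inner := innerVerts_comm H s t ▸ h.inner
  inner_parent := innerVerts_comm H s t ▸ h.inner_parent
  parent_eq := h.parent_eq
  depth_lt := h.depth_lt
  pair := h.pair.symm.imp And.symm And.symm

theorem IsEnd.swap (h : D.IsEnd H s t u v) : D.swap.IsEnd H t s u v :=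
  ⟨innerVerts_comm H s t ▸ h.1, h.2.symm⟩

namespace Describes

theorem swap (h : D.Describes H s t) : D.swap.Describes H t s where
  ne := h.ne.symm
  connected := h.connected
  source_mem := h.sink_mem
  sink_mem := h.source_mem
  root_or_child x hx := (h.root_or_child x (innerVerts_comm H s t ▸ hx)).imp
    (fun hr => middles_swap (D := D) ▸ hr) IsChild.swap
  edge u v huv := by
    rcases h.edge u v huv with h | h | h | h
    exacts [.inr (.inl h), .inl h, .inr (.inr (.inl h.swap)), .inr (.inr (.inr h.swap))]
  left x hx := by
    simpa only [LinkedLeft, LinkedRight, innerVerts_comm H t s] using!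
      h.right x (innerVerts_comm H s t ▸ hx)
  right x hx := by
    simpa only [LinkedLeft, LinkedRight, innerVerts_comm H t s] using!
      h.left x (innerVerts_comm H s t ▸ hx)

theorem left_eq_or (h : D.Describes H s t) (hx : x ∈ innerVerts H s t) :
    D.left x = s ∨ (D.left x ∈ innerVerts H s t ∧ D.depth (D.left x) < D.depth x) := by
  induction hn : D.depth x using Nat.strong_induction_on generalizing x with
  | _ n ih =>
    subst hn
    rcases h.root_or_child x hx with hr | hp
    · exact .inl hr.2.1
    rcases hp.pair with ⟨hl, -⟩ | ⟨hl, -⟩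
    · rw [hl]
      exact (ih _ hp.depth_lt hp.inner_parent rfl).imp_right (And.imp_right hp.depth_lt.trans')
    · rw [hl]
      exact .inr ⟨hp.inner_parent, hp.depth_lt⟩

theorem right_eq_or (h : D.Describes H s t) (hx : x ∈ innerVerts H s t) :
    D.right x = t ∨ (D.right x ∈ innerVerts H s t ∧ D.depth (D.right x) < D.depth x) := by
  simpa only [innerVerts_comm H t s] using! h.swap.left_eq_or (innerVerts_comm H s t ▸ hx)

theorem left_mem (h : D.Describes H s t) (hx : x ∈ innerVerts H s t) : D.left x ∈ H.verts :=
  (h.left_eq_or hx).elim (fun hs => hs ▸ h.source_mem) fun hi => hi.1.1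

theorem right_mem (h : D.Describes H s t) (hx : x ∈ innerVerts H s t) : D.right x ∈ H.verts :=
  (h.right_eq_or hx).elim (fun ht => ht ▸ h.sink_mem) fun hi => hi.1.1

theorem depth_left_lt (h : D.Describes H s t) (hx : x ∈ innerVerts H s t)
    (hl : D.left x ∈ innerVerts H s t) : D.depth (D.left x) < D.depth x :=
  ((h.left_eq_or hx).resolve_left fun hs => hl.2 (.inl hs)).2

theorem depth_right_lt (h : D.Describes H s t) (hx : x ∈ innerVerts H s t)
    (hr : D.right x ∈ innerVerts H s t) : D.depth (D.right x) < D.depth x :=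
  ((h.right_eq_or hx).resolve_left fun ht => hr.2 (.inr ht)).2

theorem left_ne (h : D.Describes H s t) (hx : x ∈ innerVerts H s t) : D.left x ≠ x := fun he =>
  (h.depth_left_lt hx (he.symm ▸ hx)).ne (congrArg D.depth he)

theorem right_ne (h : D.Describes H s t) (hx : x ∈ innerVerts H s t) : D.right x ≠ x := fun he =>
  (h.depth_right_lt hx (he.symm ▸ hx)).ne (congrArg D.depth he)

theorem left_ne_right (h : D.Describes H s t) (hx : x ∈ innerVerts H s t) :
    D.left x ≠ D.right x := by
  rcases h.root_or_child x hx with ⟨-, hl, hr⟩ | hp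
  · rw [hl, hr]
    exact h.ne
  · rcases hp.pair with ⟨hl, hr⟩ | ⟨hl, hr⟩ <;> rw [hl, hr]
    · exact h.left_ne hp.inner_parent
    · exact (h.right_ne hp.inner_parent).symm

theorem isChild_of_mem_middles_left (h : D.Describes H s t) (hx : x ∈ innerVerts H s t)
    (hy : y ∈ D.middles H s t (D.left x) x) : D.IsChild H s t y x := by
  obtain ⟨hyi, hyl, hyr⟩ := hy
  rcases h.root_or_child y hyi with ⟨-, -, ht⟩ | hp
  · exact (hx.2 (.inr (hyr.symm.trans ht))).elim
  rcases hp.pair with ⟨-, hpr⟩ | ⟨hpl, hpr⟩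
  · exact hyr ▸ hpr ▸ hp
  · have hlx : D.left x = D.parent y := hyl.symm.trans hpl
    have hrp : D.right (D.parent y) = x := hpr.symm.trans hyr
    have h₁ := h.depth_left_lt hx (hlx ▸ hp.inner_parent)
    have h₂ := h.depth_right_lt hp.inner_parent (hrp.symm ▸ hx)
    rw [hlx] at h₁
    rw [hrp] at h₂
    exact (h₁.asymm h₂).elim

theorem isChild_of_mem_middles_right (h : D.Describes H s t) (hx : x ∈ innerVerts H s t)
    (hy : y ∈ D.middles H s t x (D.right x)) : D.IsChild H s t y x :=
  (h.swap.isChild_of_mem_middles_left (innerVerts_comm H s t ▸ hx)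
    (middles_swap (D := D) ▸ hy)).swap

theorem isChild_of_isChild_of_mem_middles (h : D.Describes H s t) (hy : y ∈ D.middles H s t u v)
    (hz : z ∈ D.middles H s t u v) (hp : D.IsChild H s t y p) : D.IsChild H s t z p := by
  obtain ⟨-, rfl, rfl⟩ := hy
  obtain ⟨hzi, hzl, hzr⟩ := hz
  rcases hp.pair with ⟨hl, hr⟩ | ⟨hl, hr⟩
  · exact h.isChild_of_mem_middles_left hp.inner_parent ⟨hzi, hzl.trans hl, hzr.trans hr⟩
  · exact h.isChild_of_mem_middles_right hp.inner_parent ⟨hzi, hzl.trans hl, hzr.trans hr⟩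

end Describes

/-- The reflexive transitive closure of `IsChild`. -/
abbrev Descends (D : Decomposition V) (H : G.Subgraph) (s t : V) : V → V → Prop :=
  ReflTransGen (D.IsChild H s t)

theorem Descends.depth_le (h : D.Descends H s t z x) : D.depth x ≤ D.depth z := by
  induction h with
  | refl => exact le_rfl
  | tail _ hp ih => exact hp.depth_lt.le.trans ih

theorem Descends.inner (h : D.Descends H s t z x) (hx : x ∈ innerVerts H s t) :
    z ∈ innerVerts H s t := by
  rcases h.cases_head with rfl | ⟨_, hp, -⟩
  exacts [hx, hp.inner]

theorem Descends.left (h : D.Descends H s t z x) :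
    D.left z = D.left x ∨ D.Descends H s t (D.left z) x := by
  induction h using ReflTransGen.head_induction_on with
  | refl => exact .inl rfl
  | head hp hd ih =>
    rcases hp.pair with ⟨hl, -⟩ | ⟨hl, -⟩ <;> rw [hl]
    exacts [ih, .inr hd]

theorem Descends.swap (h : D.Descends H s t z x) : D.swap.Descends H t s z x :=
  ReflTransGen.mono (fun _ _ => IsChild.swap) _ _ h

theorem Descends.right (h : D.Descends H s t z x) :
    D.right z = D.right x ∨ D.Descends H s t (D.right z) x :=
  h.swap.left.imp_right Descends.swap

theorem not_descends_of_isChild_imp (hyz : y ≠ z)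
    (h : ∀ p, D.IsChild H s t y p → D.IsChild H s t z p) : ¬ D.Descends H s t y z := fun hd => by
  obtain rfl | ⟨p, hp, hpz⟩ := hd.cases_head
  · exact hyz rfl
  · exact (h p hp).depth_lt.not_ge (Descends.depth_le hpz)

theorem disjoint_descendants (hyz : y ≠ z) (h : ∀ p, D.IsChild H s t y p ↔ D.IsChild H s t z p) :
    Disjoint {w | D.Descends H s t w y} {w | D.Descends H s t w z} := by
  refine Set.disjoint_left.2 fun w hy hz => ?_
  rcases ReflTransGen.total_of_right_unique
    (fun _ _ _ h₁ h₂ => h₁.parent_eq.symm.trans h₂.parent_eq) hy hz with h' | h'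
  · exact not_descends_of_isChild_imp hyz (fun p => (h p).1) h'
  · exact not_descends_of_isChild_imp hyz.symm (fun p => (h p).2) h'

namespace Describes

theorem not_descends_left (h : D.Describes H s t) (hx : x ∈ innerVerts H s t) :
    ¬ D.Descends H s t (D.left x) x := fun hd =>
  (h.depth_left_lt hx (hd.inner hx)).not_ge hd.depth_le

theorem not_descends_right (h : D.Describes H s t) (hx : x ∈ innerVerts H s t) :
    ¬ D.Descends H s t (D.right x) x := fun hd =>
  (h.depth_right_lt hx (hd.inner hx)).not_ge hd.depth_le

theorem descends_iff (h : D.Describes H s t) (hx : x ∈ innerVerts H s t) :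
    D.Descends H s t z x ↔ z = x ∨ (∃ y ∈ D.middles H s t (D.left x) x, D.Descends H s t z y) ∨
      ∃ y ∈ D.middles H s t x (D.right x), D.Descends H s t z y := by
  refine ⟨fun hd => ?_, ?_⟩
  · obtain rfl | ⟨y, hzy, hyx⟩ := hd.cases_tail
    · exact .inl rfl
    · exact .inr (hyx.pair.imp (fun hp => ⟨y, ⟨hyx.inner, hp⟩, hzy⟩)
        fun hp => ⟨y, ⟨hyx.inner, hp⟩, hzy⟩)
  · rintro (rfl | ⟨y, hy, hzy⟩ | ⟨y, hy, hzy⟩)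
    exacts [.refl, hzy.tail (h.isChild_of_mem_middles_left hx hy),
      hzy.tail (h.isChild_of_mem_middles_right hx hy)]

theorem exists_root (h : D.Describes H s t) (hx : x ∈ innerVerts H s t) :
    ∃ y ∈ D.middles H s t s t, D.Descends H s t x y := by
  induction hn : D.depth x using Nat.strong_induction_on generalizing x with
  | _ n ih =>
    subst hn
    rcases h.root_or_child x hx with hr | hp
    · exact ⟨x, hr, .refl⟩
    · obtain ⟨y, hy, hd⟩ := ih _ hp.depth_lt hp.inner_parent rfl
      exact ⟨y, hy, hd.head hp⟩

theorem adj_or_nonempty_middles_left (h : D.Describes H s t) (hx : x ∈ innerVerts H s t) :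
    H.Adj (D.left x) x ∨ (D.middles H s t (D.left x) x).Nonempty := by
  obtain ⟨y, hxy, rfl | ⟨hy, hyx⟩⟩ := h.left x hx
  · exact .inl hxy.symm
  right
  clear hxy
  induction hn : D.depth y using Nat.strong_induction_on generalizing y with
  | _ n ih =>
    subst hn
    rcases h.root_or_child y hy with ⟨-, -, ht⟩ | hp
    · exact (hx.2 (.inr (hyx.symm.trans ht))).elim
    rcases hp.pair with ⟨hl, hr⟩ | ⟨-, hr⟩
    · exact ⟨y, hy, by rw [hl, ← hr, hyx], hyx⟩
    · exact ih _ hp.depth_lt _ hp.inner_parent (hr.symm.trans hyx) rfl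

theorem adj_or_nonempty_middles_right (h : D.Describes H s t) (hx : x ∈ innerVerts H s t) :
    H.Adj x (D.right x) ∨ (D.middles H s t x (D.right x)).Nonempty := by
  rw [← middles_swap (D := D), H.adj_comm]
  exact h.swap.adj_or_nonempty_middles_left (innerVerts_comm H s t ▸ hx)

theorem adj_or_nonempty_middles_terminals (h : D.Describes H s t) :
    H.Adj s t ∨ (D.middles H s t s t).Nonempty := by
  by_cases hne : (innerVerts H s t).Nonempty
  · obtain ⟨x, hx⟩ := hne
    obtain ⟨y, hy, -⟩ := h.exists_root hx
    exact .inr ⟨y, hy⟩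
  · have hmem : ∀ w ∈ H.verts, w = s ∨ w = t := fun w hw => by
      by_contra hws
      exact hne ⟨w, hw, hws⟩
    have : Nontrivial H.verts :=
      ⟨⟨s, h.source_mem⟩, ⟨t, h.sink_mem⟩, fun he => h.ne (congrArg Subtype.val he)⟩
    obtain ⟨w, hsw : H.Adj s w⟩ :=
      h.connected.preconnected.coe.exists_adj_of_nontrivial ⟨s, h.source_mem⟩
    exact .inl ((hmem w w.2).resolve_left (Subgraph.Adj.ne hsw).symm ▸ hsw)

end Describes

/-- The subgraph of `H` formed by the edges joining a vertex of `X` to a terminal of its series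
composition; for a set `X` of inner vertices closed under descending, these are the edges added
in `X`. -/
def span (D : Decomposition V) (H : G.Subgraph) (X : Set V) : G.Subgraph where
  verts := X ∪ D.left '' X ∪ D.right '' X
  Adj u v := H.Adj u v ∧
    ((v ∈ X ∧ (u = D.left v ∨ u = D.right v)) ∨ (u ∈ X ∧ (v = D.left u ∨ v = D.right u)))
  adj_sub h := H.adj_sub h.1
  edge_vert := by
    rintro u v ⟨-, ⟨hv, rfl | rfl⟩ | ⟨hu, -⟩⟩
    exacts [.inl (.inr ⟨v, hv, rfl⟩), .inr ⟨v, hv, rfl⟩, .inl (.inl hu)]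
  symm := ⟨fun _ _ h => ⟨h.1.symm, h.2.symm⟩⟩

theorem span_union (X Y : Set V) : D.span H (X ∪ Y) = D.span H X ⊔ D.span H Y := by
  ext u v
  · simp only [span, Set.image_union, Subgraph.verts_sup, Set.mem_union]
    tauto
  · simp only [span, Subgraph.sup_adj, Set.mem_union]
    tauto

theorem span_biUnion {ι : Type*} (Y : Set ι) (X : ι → Set V) :
    D.span H (⋃ y ∈ Y, X y) = ⨆ y ∈ Y, D.span H (X y) := by
  ext u v
  · simp only [span, Set.image_iUnion, Subgraph.verts_iSup, Set.mem_union, Set.mem_iUnion,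
      exists_prop, ← exists_or, ← and_or_left]
  · simp only [span, Subgraph.iSup_adj, Set.mem_iUnion, exists_prop]
    constructor
    · rintro ⟨huv, ⟨⟨y, hy, hv⟩, hu⟩ | ⟨⟨y, hy, hu⟩, hv⟩⟩
      exacts [⟨y, hy, huv, .inl ⟨hv, hu⟩⟩, ⟨y, hy, huv, .inr ⟨hu, hv⟩⟩]
    · rintro ⟨y, hy, huv, ⟨hv, hu⟩ | ⟨hu, hv⟩⟩
      exacts [⟨huv, .inl ⟨⟨y, hy, hv⟩, hu⟩⟩, ⟨huv, .inr ⟨⟨y, hy, hu⟩, hv⟩⟩]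

theorem span_singleton : D.span H {x} = H.induce {D.left x, x} ⊔ H.induce {x, D.right x} := by
  ext u v
  · simp only [span, Set.image_singleton, Subgraph.verts_sup, Subgraph.induce_verts, Set.mem_union,
      Set.mem_insert_iff, Set.mem_singleton_iff]
    tauto
  · simp only [span, Subgraph.sup_adj, Subgraph.induce_adj, Set.mem_insert_iff,
      Set.mem_singleton_iff]
    have hirr : H.Adj u v → u ≠ v := fun h => h.ne
    constructor
    · rintro ⟨huv, ⟨rfl, h⟩ | ⟨rfl, h⟩⟩ <;> tauto
    · rintro (⟨rfl | rfl, rfl | rfl, huv⟩ | ⟨rfl | rfl, rfl | rfl, huv⟩) <;> tauto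

/-- The series composition of the inner vertex `x`. -/
abbrev component (D : Decomposition V) (H : G.Subgraph) (s t x : V) : G.Subgraph :=
  D.span H {z | D.Descends H s t z x}

/-- The parallel composition of all series compositions with terminals `u`, `v` and of the edge
`uv`, if there is one. -/
def bundle (D : Decomposition V) (H : G.Subgraph) (s t u v : V) : G.Subgraph :=
  H.induce {u, v} ⊔ ⨆ y ∈ D.middles H s t u v, D.component H s t y

theorem verts_component (x : V) :
    (D.component H s t x).verts = {D.left x, D.right x} ∪ {z | D.Descends H s t z x} := by
  ext z
  simp only [component, span, Set.mem_union, Set.mem_image, Set.mem_ofPred_eq, Set.mem_insert_iff,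
    Set.mem_singleton_iff]
  constructor
  · rintro ((hz | ⟨w, hw, rfl⟩) | ⟨w, hw, rfl⟩)
    exacts [.inr hz, hw.left.imp_left .inl, hw.right.imp_left .inr]
  · rintro ((rfl | rfl) | hz)
    exacts [.inl (.inr ⟨x, .refl, rfl⟩), .inr ⟨x, .refl, rfl⟩, .inl (.inl hz)]

theorem verts_bundle (u v : V) : (D.bundle H s t u v).verts =
    {u, v} ∪ ⋃ y ∈ D.middles H s t u v, {z | D.Descends H s t z y} := by
  ext z
  simp only [bundle, Subgraph.verts_sup, Subgraph.verts_iSup, Subgraph.induce_verts,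
    verts_component, Set.mem_union, Set.mem_iUnion, exists_prop]
  refine ⟨?_, Or.imp_right fun ⟨y, hy, hz⟩ => ⟨y, hy, .inr hz⟩⟩
  rintro (hz | ⟨y, hy, hz | hz⟩)
  · exact .inl hz
  · exact .inl (hy.2.1 ▸ hy.2.2 ▸ hz)
  · exact .inr ⟨y, hy, hz⟩

namespace Describes

theorem not_adj_component (h : D.Describes H s t) (hx : x ∈ innerVerts H s t) :
    ¬ (D.component H s t x).Adj (D.left x) (D.right x) := by
  rintro ⟨-, ⟨hr, -⟩ | ⟨hl, -⟩⟩
  exacts [h.not_descends_right hx hr, h.not_descends_left hx hl]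

theorem disjoint_descendants_of_mem_middles (h : D.Describes H s t)
    (hy : y ∈ D.middles H s t u v) (hz : z ∈ D.middles H s t u v) (hyz : y ≠ z) :
    Disjoint {w | D.Descends H s t w y} {w | D.Descends H s t w z} :=
  disjoint_descendants hyz fun _ => ⟨h.isChild_of_isChild_of_mem_middles hy hz,
    h.isChild_of_isChild_of_mem_middles hz hy⟩

theorem component_inter_subset (h : D.Describes H s t) (hy : y ∈ D.middles H s t u v)
    (hz : z ∈ D.middles H s t u v) (hyz : y ≠ z) :
    (D.component H s t y).verts ∩ (D.component H s t z).verts ⊆ {u, v} := by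
  rw [verts_component, verts_component, hy.2.1, hy.2.2, hz.2.1, hz.2.2,
    ← Set.union_inter_distrib_left, (h.disjoint_descendants_of_mem_middles hy hz hyz).inter_eq,
    Set.union_empty]

theorem component_eq (h : D.Describes H s t) (hx : x ∈ innerVerts H s t) :
    D.component H s t x = D.bundle H s t (D.left x) x ⊔ D.bundle H s t x (D.right x) := by
  have hdesc : {z | D.Descends H s t z x} = {x} ∪
      ((⋃ y ∈ D.middles H s t (D.left x) x, {z | D.Descends H s t z y}) ∪
        ⋃ y ∈ D.middles H s t x (D.right x), {z | D.Descends H s t z y}) := by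
    ext z
    simpa using h.descends_iff hx
  rw [component, hdesc, span_union, span_union, span_biUnion, span_biUnion, span_singleton,
    sup_sup_sup_comm, bundle, bundle]

theorem bundle_terminals_eq (h : D.Describes H s t) : D.bundle H s t s t = H := by
  have hinner : (⋃ y ∈ D.middles H s t s t, {z | D.Descends H s t z y}) = innerVerts H s t := by
    ext z
    simp only [Set.mem_iUnion, exists_prop]
    exact ⟨fun ⟨y, hy, hz⟩ => hz.inner hy.1, h.exists_root⟩
  rw [bundle, ← span_biUnion, hinner]
  ext u v
  · simp only [Subgraph.verts_sup, Subgraph.induce_verts, span]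
    constructor
    · rintro ((rfl | rfl) | (hu | ⟨w, hw, rfl⟩) | ⟨w, hw, rfl⟩)
      exacts [h.source_mem, h.sink_mem, hu.1,
        h.left_mem hw, h.right_mem hw]
    · intro hu
      by_cases hst : u ∈ ({s, t} : Set V)
      exacts [.inl hst, .inr (.inl (.inl ⟨hu, hst⟩))]
  · simp only [Subgraph.sup_adj, Subgraph.induce_adj, span]
    refine ⟨fun huv => huv.elim (fun h => h.2.2) And.left, fun huv => ?_⟩
    rcases h.edge u v huv with ⟨rfl, rfl⟩ | ⟨rfl, rfl⟩ | hv | hu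
    exacts [.inl ⟨.inl rfl, .inr rfl, huv⟩, .inl ⟨.inr rfl, .inl rfl, huv⟩, .inr ⟨huv, .inl hv⟩,
      .inr ⟨huv, .inr hu⟩]

theorem bundle_inter_bundle (h : D.Describes H s t) (hx : x ∈ innerVerts H s t) :
    (D.bundle H s t (D.left x) x).verts ∩ (D.bundle H s t x (D.right x)).verts = {x} := by
  rw [verts_bundle, verts_bundle]
  refine Set.Subset.antisymm (fun z hz => ?_)
    (Set.singleton_subset_iff.2 ⟨.inl (.inr rfl), .inl (.inl rfl)⟩)
  simp only [Set.mem_inter_iff, Set.mem_union, Set.mem_iUnion, exists_prop] at hz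
  obtain ⟨(rfl | hz₁) | ⟨y, hy, hzy⟩, (hz₂ | hz₂) | ⟨y', hy', hzy'⟩⟩ := hz
  · exact hz₂
  · exact (h.left_ne_right hx hz₂).elim
  · exact (h.not_descends_left hx (hzy'.tail (h.isChild_of_mem_middles_right hx hy'))).elim
  iterate 3 exact hz₁
  · exact hz₂
  · cases hz₂
    exact (h.not_descends_right hx (hzy.tail (h.isChild_of_mem_middles_left hx hy))).elim
  · have hyx := h.isChild_of_mem_middles_left hx hy
    have hyx' := h.isChild_of_mem_middles_right hx hy'
    have hne : y ≠ y' := by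
      rintro rfl
      exact h.left_ne hx (hy.2.1.symm.trans hy'.2.1)
    refine (Set.disjoint_left.1 (disjoint_descendants hne fun p => ?_) hzy hzy').elim
    exact ⟨fun hp => (hyx.parent_eq.symm.trans hp.parent_eq) ▸ hyx',
      fun hp => (hyx'.parent_eq.symm.trans hp.parent_eq) ▸ hyx⟩

theorem isTwoTerminalSP_bundle [Finite V] (h : D.Describes H s t)
    (hne : H.Adj u v ∨ (D.middles H s t u v).Nonempty)
    (hC : ∀ y ∈ D.middles H s t u v, IsTwoTerminalSP G (D.component H s t y) u v) :
    IsTwoTerminalSP G (D.bundle H s t u v) u v :=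
  IsTwoTerminalSP.induce_sup_biSup (Set.toFinite _) hne hC
    (fun _ hy => hy.2.1 ▸ hy.2.2 ▸ h.not_adj_component hy.1)
    fun _ hy _ hz hyz => h.component_inter_subset hy hz hyz

theorem isTwoTerminalSP_component [Finite V] (h : D.Describes H s t)
    (hx : x ∈ innerVerts H s t) :
    IsTwoTerminalSP G (D.component H s t x) (D.left x) (D.right x) := by
  have hwf : WellFounded fun y x : V => D.depth x < D.depth y :=
    @Finite.wellFounded_of_trans_of_irrefl V _ _ ⟨fun _ _ _ h₁ h₂ => h₂.trans h₁⟩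
      ⟨fun _ => lt_irrefl _⟩
  induction x using hwf.induction with
  | _ x ih =>
    rw [h.component_eq hx]
    refine .series (m := x) (h.isTwoTerminalSP_bundle (h.adj_or_nonempty_middles_left hx) ?_)
      (h.isTwoTerminalSP_bundle (h.adj_or_nonempty_middles_right hx) ?_) (h.bundle_inter_bundle hx)
    · intro y hy
      have hsp := ih y (h.isChild_of_mem_middles_left hx hy).depth_lt hy.1
      rwa [hy.2.1, hy.2.2] at hsp
    · intro y hy
      have hsp := ih y (h.isChild_of_mem_middles_right hx hy).depth_lt hy.1
      rwa [hy.2.1, hy.2.2] at hsp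

theorem isTwoTerminalSP_component_of_mem_middles [Finite V] (h : D.Describes H s t)
    (hx : x ∈ D.middles H s t u v) : IsTwoTerminalSP G (D.component H s t x) u v := by
  obtain ⟨hxi, rfl, rfl⟩ := hx
  exact h.isTwoTerminalSP_component hxi

theorem isTwoTerminalSP [Finite V] (h : D.Describes H s t) : IsTwoTerminalSP G H s t := by
  have hsp := h.isTwoTerminalSP_bundle h.adj_or_nonempty_middles_terminals
    fun _ => h.isTwoTerminalSP_component_of_mem_middles
  rwa [h.bundle_terminals_eq] at hsp

theorem isCutVertex_of_middles_eq_singleton [Finite V] (h : D.Describes (⊤ : G.Subgraph) s t)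
    (hst : ¬ G.Adj s t) {m : V} (hm : D.middles (⊤ : G.Subgraph) s t s t = {m}) :
    IsCutVertex G m := by
  have hmem : m ∈ D.middles (⊤ : G.Subgraph) s t s t := hm.symm ▸ rfl
  have htop : D.component (⊤ : G.Subgraph) s t m = ⊤ := by
    have hsp := h.isTwoTerminalSP_component_of_mem_middles hmem
    have hle := induce_pair_le (H := ⊤) hst hsp.source_mem hsp.sink_mem
    have hbundle := h.bundle_terminals_eq
    rwa [bundle, hm, iSup_singleton, sup_eq_right.2 hle] at hbundle
  have hmi := hmem.1
  rw [h.component_eq hmi] at htop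
  exact isCutVertex_of_sup_eq_top htop (h.bundle_inter_bundle hmi) (.inl (.inl rfl))
    (h.left_ne hmi) (.inl (.inr rfl)) (h.right_ne hmi)

theorem isTwoConnected_iff [Finite V] (h : D.Describes (⊤ : G.Subgraph) s t) :
    IsTwoConnected G ↔ G.Adj s t ∨ (D.middles (⊤ : G.Subgraph) s t s t).Nontrivial := by
  constructor
  · rintro ⟨-, hcut⟩
    by_contra! hst
    obtain ⟨m, hm⟩ := h.adj_or_nonempty_middles_terminals.resolve_left hst.1
    exact hcut m (h.isCutVertex_of_middles_eq_singleton hst.1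
      (hst.2.eq_singleton_of_mem hm))
  · refine fun hst => h.isTwoTerminalSP.isTwoConnected fun c hcs hct => ?_
    rcases hst with hst | ⟨x, hx, y, hy, hxy⟩
    · exact ⟨G.subgraphOfAdj hst, Subgraph.subgraphOfAdj_connected hst, by simp [hcs, hct],
        by simp, by simp⟩
    have hspx := h.isTwoTerminalSP_component_of_mem_middles hx
    have hspy := h.isTwoTerminalSP_component_of_mem_middles hy
    by_cases hc : c ∈ (D.component (⊤ : G.Subgraph) s t x).verts
    · refine ⟨_, hspy.connected, fun hcy => ?_, hspy.source_mem, hspy.sink_mem⟩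
      exact (h.component_inter_subset hx hy hxy ⟨hc, hcy⟩).elim hcs hct
    · exact ⟨_, hspx.connected, hc, hspx.source_mem, hspx.sink_mem⟩

end Describes

end Decomposition

/-! ### Composing decompositions -/

section Terminals

variable {A B : G.Subgraph} {s m t : V}

theorem innerVerts_sup_parallel : innerVerts (A ⊔ B) s t = innerVerts A s t ∪ innerVerts B s t :=
  Set.union_sdiff_distrib

theorem source_notMem_of_inter_eq_singleton (hverts : A.verts ∩ B.verts = {m}) (hs : s ∈ A.verts)
    (hne : s ≠ m) : s ∉ B.verts := fun hsB =>
  hne (hverts.subset ⟨hs, hsB⟩)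

theorem sink_notMem_of_inter_eq_singleton (hverts : A.verts ∩ B.verts = {m}) (ht : t ∈ B.verts)
    (hne : m ≠ t) : t ∉ A.verts := fun htA =>
  hne (hverts.subset ⟨htA, ht⟩).symm

theorem innerVerts_sup_series (hverts : A.verts ∩ B.verts = {m}) (hs : s ∈ A.verts)
    (ht : t ∈ B.verts) (hsm : s ≠ m) (hmt : m ≠ t) :
    innerVerts (A ⊔ B) s t = insert m (innerVerts A s m ∪ innerVerts B m t) := by
  have hsB := source_notMem_of_inter_eq_singleton hverts hs hsm
  have htA := sink_notMem_of_inter_eq_singleton hverts ht hmt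
  have hmA : m ∈ A.verts := (hverts.superset rfl).1
  ext x
  simp only [innerVerts, Subgraph.verts_sup, Set.mem_sdiff, Set.mem_union, Set.mem_insert_iff,
    Set.mem_singleton_iff]
  constructor
  · tauto
  · rintro (rfl | ⟨hx, hne⟩ | ⟨hx, hne⟩)
    · exact ⟨.inl hmA, not_or.2 ⟨hsm.symm, hmt⟩⟩
    · exact ⟨.inl hx, not_or.2 ⟨fun h => hne (.inl h), fun h => htA (h ▸ hx)⟩⟩
    · exact ⟨.inr hx, not_or.2 ⟨fun h => hsB (h ▸ hx), fun h => hne (.inr h)⟩⟩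

end Terminals

namespace Decomposition

/-- `D` and `D₀` have the same terminals and parents and the same order of depths on `X`. -/
structure AgreesOn (D D₀ : Decomposition V) (X : Set V) : Prop where
  left : Set.EqOn D.left D₀.left X
  right : Set.EqOn D.right D₀.right X
  parent : Set.EqOn D.parent D₀.parent X
  depth : ∀ x ∈ X, ∀ y ∈ X, D₀.depth x < D₀.depth y → D.depth x < D.depth y

/-- The decomposition that is `D₁` on `S` and `D₂` elsewhere. -/
def glue (S : Set V) [DecidablePred (· ∈ S)] (D₁ D₂ : Decomposition V) :
    Decomposition V where
  left := S.piecewise D₁.left D₂.left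
  right := S.piecewise D₁.right D₂.right
  parent := S.piecewise D₁.parent D₂.parent
  depth := S.piecewise D₁.depth D₂.depth

/-- Makes `m` the only middle with terminals `s`, `t` of a series composition, on top of `D`. -/
def insertMiddle [DecidableEq V] (D : Decomposition V) (s m t : V) : Decomposition V where
  left := Function.update D.left m s
  right := Function.update D.right m t
  parent := Function.update D.parent m s
  depth := Function.update (fun x => D.depth x + 1) m 0

section AgreesOn

variable {D D₀ D₁ D₂ : Decomposition V} {X Y S : Set V} {s m t : V}

theorem AgreesOn.trans (h : D.AgreesOn D₁ X) (h₀ : D₁.AgreesOn D₀ Y) (hYX : Y ⊆ X) :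
    D.AgreesOn D₀ Y where
  left := (h.left.mono hYX).trans h₀.left
  right := (h.right.mono hYX).trans h₀.right
  parent := (h.parent.mono hYX).trans h₀.parent
  depth x hx y hy hxy := h.depth x (hYX hx) y (hYX hy) (h₀.depth x hx y hy hxy)

theorem agreesOn_glue_left [DecidablePred (· ∈ S)] (hX : X ⊆ S) : (glue S D₁ D₂).AgreesOn D₁ X where
  left := (S.piecewise_eqOn _ _).mono hX
  right := (S.piecewise_eqOn _ _).mono hX
  parent := (S.piecewise_eqOn _ _).mono hX
  depth x hx y hy := by
    simp only [glue, Set.piecewise_eq_of_mem _ _ _ (hX hx), Set.piecewise_eq_of_mem _ _ _ (hX hy),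
      imp_self]

theorem agreesOn_glue_right [DecidablePred (· ∈ S)] (hX : Disjoint X S) :
    (glue S D₁ D₂).AgreesOn D₂ X where
  left := (S.piecewise_eqOn_compl _ _).mono hX.subset_compl_right
  right := (S.piecewise_eqOn_compl _ _).mono hX.subset_compl_right
  parent := (S.piecewise_eqOn_compl _ _).mono hX.subset_compl_right
  depth x hx y hy := by
    simp only [glue, Set.piecewise_eq_of_notMem _ _ _ (hX.notMem_of_mem_left hx),
      Set.piecewise_eq_of_notMem _ _ _ (hX.notMem_of_mem_left hy), imp_self]

theorem agreesOn_insertMiddle [DecidableEq V] : (D.insertMiddle s m t).AgreesOn D {m}ᶜ where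
  left _ hx := Function.update_of_ne hx _ _
  right _ hx := Function.update_of_ne hx _ _
  parent _ hx := Function.update_of_ne hx _ _
  depth x hx y hy hxy := by
    simpa only [insertMiddle, Function.update_of_ne (show x ≠ m from hx),
      Function.update_of_ne (show y ≠ m from hy), add_lt_add_iff_right]

theorem depth_insertMiddle_lt [DecidableEq V] {x : V} (hx : x ≠ m) :
    (D.insertMiddle s m t).depth m < (D.insertMiddle s m t).depth x := by
  simp only [insertMiddle, Function.update_self, Function.update_of_ne hx, Nat.succ_pos]

end AgreesOn

/-- `D` extends the decomposition `D₀` of the part `H₀`, with terminals `s₀` and `t₀`, of `H`. -/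
structure Extends (D D₀ : Decomposition V) (H₀ : G.Subgraph) (s₀ t₀ : V) (H : G.Subgraph)
    (s t : V) : Prop where
  le : H₀ ≤ H
  inner_subset : innerVerts H₀ s₀ t₀ ⊆ innerVerts H s t
  agreesOn : D.AgreesOn D₀ (innerVerts H₀ s₀ t₀)

namespace Extends

variable {D D₀ : Decomposition V} {H₀ H : G.Subgraph} {s₀ t₀ s t u v x a p : V}

theorem isEnd (E : D.Extends D₀ H₀ s₀ t₀ H s t) (h : D₀.IsEnd H₀ s₀ t₀ u v) :
    D.IsEnd H s t u v := by
  refine ⟨E.inner_subset h.1, ?_⟩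
  rw [E.agreesOn.left h.1, E.agreesOn.right h.1]
  exact h.2

theorem isChild (E : D.Extends D₀ H₀ s₀ t₀ H s t) (h : D₀.IsChild H₀ s₀ t₀ x p) :
    D.IsChild H s t x p where
  inner := E.inner_subset h.inner
  inner_parent := E.inner_subset h.inner_parent
  parent_eq := (E.agreesOn.parent h.inner).trans h.parent_eq
  depth_lt := E.agreesOn.depth _ h.inner_parent _ h.inner h.depth_lt
  pair := by
    rw [E.agreesOn.left h.inner, E.agreesOn.right h.inner, E.agreesOn.left h.inner_parent,
      E.agreesOn.right h.inner_parent]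
    exact h.pair

theorem linkedLeft (E : D.Extends D₀ H₀ s₀ t₀ H s t) (h : D₀.LinkedLeft H₀ s₀ t₀ x a) :
    D.LinkedLeft H s t x a := by
  obtain ⟨y, hxy, hy⟩ := h
  exact ⟨y, E.le.2 hxy, hy.imp_right fun h =>
    ⟨E.inner_subset h.1, (E.agreesOn.right h.1).trans h.2⟩⟩

theorem linkedRight (E : D.Extends D₀ H₀ s₀ t₀ H s t) (h : D₀.LinkedRight H₀ s₀ t₀ x a) :
    D.LinkedRight H s t x a := by
  obtain ⟨y, hxy, hy⟩ := h
  exact ⟨y, E.le.2 hxy, hy.imp_right fun h =>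
    ⟨E.inner_subset h.1, (E.agreesOn.left h.1).trans h.2⟩⟩

theorem linkedLeft_left (E : D.Extends D₀ H₀ s₀ t₀ H s t) (h : D₀.Describes H₀ s₀ t₀)
    (hx : x ∈ innerVerts H₀ s₀ t₀) : D.LinkedLeft H s t x (D.left x) := by
  rw [E.agreesOn.left hx]
  exact E.linkedLeft (h.left x hx)

theorem linkedRight_right (E : D.Extends D₀ H₀ s₀ t₀ H s t) (h : D₀.Describes H₀ s₀ t₀)
    (hx : x ∈ innerVerts H₀ s₀ t₀) : D.LinkedRight H s t x (D.right x) := by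
  rw [E.agreesOn.right hx]
  exact E.linkedRight (h.right x hx)

theorem root_or_child (E : D.Extends D₀ H₀ s₀ t₀ H s t) (h : D₀.Describes H₀ s₀ t₀)
    (hx : x ∈ innerVerts H₀ s₀ t₀) :
    x ∈ D₀.middles H₀ s₀ t₀ s₀ t₀ ∨ D.IsChild H s t x (D.parent x) := by
  rw [E.agreesOn.parent hx]
  exact (h.root_or_child x hx).imp_right E.isChild

theorem edge (E : D.Extends D₀ H₀ s₀ t₀ H s t) (h : D₀.Describes H₀ s₀ t₀) (huv : H₀.Adj u v) :
    (u = s₀ ∧ v = t₀) ∨ (u = t₀ ∧ v = s₀) ∨ D.IsEnd H s t u v ∨ D.IsEnd H s t v u :=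
  (h.edge u v huv).imp_right (Or.imp_right (Or.imp E.isEnd E.isEnd))

theorem mem_middles (E : D.Extends D₀ H₀ s₀ t₀ H s t) (hx : x ∈ innerVerts H₀ s₀ t₀) :
    x ∈ D.middles H s t u v ↔ x ∈ D₀.middles H₀ s₀ t₀ u v := by
  simp only [middles, Set.mem_ofPred_eq, E.inner_subset hx, hx, E.agreesOn.left hx,
    E.agreesOn.right hx]

end Extends

namespace Describes

variable {D DA DB : Decomposition V} {A B H : G.Subgraph} {s m t x : V}

theorem linkedLeft_sink (h : D.Describes H s t) : D.LinkedLeft H s t t s := by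
  have : Nontrivial H.verts :=
    ⟨⟨s, h.source_mem⟩, ⟨t, h.sink_mem⟩, fun he => h.ne (congrArg Subtype.val he)⟩
  obtain ⟨y, hty : H.Adj t y⟩ :=
    h.connected.preconnected.coe.exists_adj_of_nontrivial ⟨t, h.sink_mem⟩
  refine ⟨y, hty, ?_⟩
  rcases h.edge _ _ hty with ⟨hts, -⟩ | ⟨-, hys⟩ | ⟨hy, htl | htr⟩ | ⟨ht, -⟩
  · exact (h.ne hts.symm).elim
  · exact .inl hys
  · rcases h.left_eq_or hy with hl | ⟨hl, -⟩ <;> rw [← htl] at hl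
    exacts [(h.ne hl.symm).elim, (hl.2 (.inr rfl)).elim]
  · exact .inr ⟨hy, htr.symm⟩
  · exact (ht.2 (.inr rfl)).elim

theorem linkedRight_source (h : D.Describes H s t) : D.LinkedRight H s t s t := by
  simpa only [LinkedLeft, LinkedRight, innerVerts_comm H t s] using! h.swap.linkedLeft_sink

theorem parallel (hA : DA.Describes A s t) (hB : DB.Describes B s t)
    (EA : D.Extends DA A s t (A ⊔ B) s t) (EB : D.Extends DB B s t (A ⊔ B) s t) :
    D.Describes (A ⊔ B) s t where
  ne := hA.ne
  connected := Subgraph.connected_sup hA.connected.preconnected hB.connected.preconnected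
    ⟨s, hA.source_mem, hB.source_mem⟩
  source_mem := .inl hA.source_mem
  sink_mem := .inl hA.sink_mem
  root_or_child := by
    rw [innerVerts_sup_parallel]
    rintro x (hx | hx)
    exacts [(EA.root_or_child hA hx).imp_left (EA.mem_middles hx).2,
      (EB.root_or_child hB hx).imp_left (EB.mem_middles hx).2]
  edge u v huv := huv.elim (EA.edge hA) (EB.edge hB)
  left := by
    rw [innerVerts_sup_parallel]
    exact fun x hx => hx.elim (EA.linkedLeft_left hA) (EB.linkedLeft_left hB)
  right := by
    rw [innerVerts_sup_parallel]
    exact fun x hx => hx.elim (EA.linkedRight_right hA) (EB.linkedRight_right hB)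

theorem eq_of_mem_middles_series (hA : DA.Describes A s m) (hB : DB.Describes B m t)
    (hverts : A.verts ∩ B.verts = {m}) (EA : D.Extends DA A s m (A ⊔ B) s t)
    (EB : D.Extends DB B m t (A ⊔ B) s t) (hx : x ∈ D.middles (A ⊔ B) s t s t) : x = m := by
  obtain ⟨hxi, hxl, hxr⟩ := hx
  rw [innerVerts_sup_series hverts hA.source_mem hB.sink_mem hA.ne hB.ne] at hxi
  rcases hxi with hxm | hxi | hxi
  · exact hxm
  · rw [EA.agreesOn.right hxi] at hxr
    exact (sink_notMem_of_inter_eq_singleton hverts hB.sink_mem hB.ne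
      (hxr ▸ hA.right_mem hxi)).elim
  · rw [EB.agreesOn.left hxi] at hxl
    exact (source_notMem_of_inter_eq_singleton hverts hA.source_mem hA.ne
      (hxl ▸ hB.left_mem hxi)).elim

theorem series (hA : DA.Describes A s m) (hB : DB.Describes B m t)
    (hverts : A.verts ∩ B.verts = {m}) (EA : D.Extends DA A s m (A ⊔ B) s t)
    (EB : D.Extends DB B m t (A ⊔ B) s t) (hm : m ∈ D.middles (A ⊔ B) s t s t)
    (hparentA : ∀ x ∈ DA.middles A s m s m, D.parent x = m)
    (hparentB : ∀ x ∈ DB.middles B m t m t, D.parent x = m)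
    (hdepth : ∀ x ≠ m, D.depth m < D.depth x) :
    D.Describes (A ⊔ B) s t := by
  have hinner := innerVerts_sup_series hverts hA.source_mem hB.sink_mem hA.ne hB.ne
  obtain ⟨hmi, hml, hmr⟩ := hm
  refine
  { ne := fun hst => ?_
    connected := Subgraph.connected_sup hA.connected.preconnected hB.connected.preconnected
      ⟨m, hA.sink_mem, hB.source_mem⟩
    source_mem := .inl hA.source_mem
    sink_mem := .inr hB.sink_mem
    root_or_child := ?_
    edge := ?_
    left := ?_
    right := ?_ }
  · exact source_notMem_of_inter_eq_singleton hverts hA.source_mem hA.ne (hst ▸ hB.sink_mem)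
  · rw [hinner]
    rintro x (rfl | hx | hx)
    · exact .inl ⟨hmi, hml, hmr⟩
    · refine .inr ((EA.root_or_child hA hx).elim (fun hr => ?_) id)
      have hp := hparentA x hr
      have hr' := (EA.mem_middles hx).2 hr
      exact ⟨hr'.1, hp ▸ hmi, rfl, hp ▸ hdepth x fun h => hx.2 (.inr h),
        .inl ⟨by rw [hr'.2.1, hp, hml], by rw [hr'.2.2, hp]⟩⟩
    · refine .inr ((EB.root_or_child hB hx).elim (fun hr => ?_) id)
      have hp := hparentB x hr
      have hr' := (EB.mem_middles hx).2 hr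
      exact ⟨hr'.1, hp ▸ hmi, rfl, hp ▸ hdepth x fun h => hx.2 (.inl h),
        .inr ⟨by rw [hr'.2.1, hp], by rw [hr'.2.2, hp, hmr]⟩⟩
  · rintro u v (huv | huv)
    · rcases EA.edge hA huv with ⟨rfl, rfl⟩ | ⟨rfl, rfl⟩ | h
      exacts [.inr (.inr (.inl ⟨hmi, .inl hml.symm⟩)), .inr (.inr (.inr ⟨hmi, .inl hml.symm⟩)),
        .inr (.inr h)]
    · rcases EB.edge hB huv with ⟨rfl, rfl⟩ | ⟨rfl, rfl⟩ | h
      exacts [.inr (.inr (.inr ⟨hmi, .inr hmr.symm⟩)), .inr (.inr (.inl ⟨hmi, .inr hmr.symm⟩)),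
        .inr (.inr h)]
  · rw [hinner]
    rintro x (rfl | hx | hx)
    exacts [hml.symm ▸ EA.linkedLeft hA.linkedLeft_sink, EA.linkedLeft_left hA hx,
      EB.linkedLeft_left hB hx]
  · rw [hinner]
    rintro x (rfl | hx | hx)
    exacts [hmr.symm ▸ EB.linkedRight hB.linkedRight_source, EA.linkedRight_right hA hx,
      EB.linkedRight_right hB hx]

end Describes

end Decomposition

/-! ### Forwarding labels inside a decomposition -/

namespace Decomposition

/-- The vertices that carry the label of `w`, when every inner vertex `y` carries the labels of
its parent and of one further vertex `τ y` (itself if there is none to carry). -/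
def carriers (D : Decomposition V) (τ : V → V) (H : G.Subgraph) (s t w : V) : Set V :=
  insert w {y ∈ innerVerts H s t | D.parent y = w ∨ τ y = w}

/-- The label of `w` can be forwarded to `x` along carriers of that label. -/
def Forwards (D : Decomposition V) (τ : V → V) (H : G.Subgraph) (s t w x : V) : Prop :=
  ∃ P ≤ H, P.Connected ∧ w ∈ P.verts ∧ x ∈ P.verts ∧ P.verts ⊆ D.carriers τ H s t w

/-- `D` is a decomposition tree in which every label that a vertex carries can be forwarded to it;
the topmost middles, which have no parent in the tree, are given the parent `z`. -/
structure Routes (D : Decomposition V) (τ : V → V) (H : G.Subgraph) (s t z : V) : Prop where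
  describes : D.Describes H s t
  parent_root : ∀ x ∈ D.middles H s t s t, D.parent x = z
  parent : ∀ x ∈ innerVerts H s t, D.Forwards τ H s t (D.parent x) x
  transit : ∀ x ∈ innerVerts H s t, D.Forwards τ H s t (τ x) x

/-- `P` connects the terminals, and its inner vertices have no further label to carry yet. -/
structure IsFreeLink (τ : V → V) (H : G.Subgraph) (s t : V) (P : G.Subgraph) : Prop where
  le : P ≤ H
  connected : P.Connected
  source_mem : s ∈ P.verts
  sink_mem : t ∈ P.verts
  idle : ∀ y ∈ innerVerts P s t, τ y = y

variable {D D₀ DA DB : Decomposition V} {τ τ₀ τA τB : V → V} {A B H H₀ P Q R : G.Subgraph}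
  {s₀ t₀ s m t w x z : V}

theorem Routes.swap (h : D.Routes τ H s t z) : D.swap.Routes τ H t s z where
  describes := h.describes.swap
  parent_root x hx := h.parent_root x (middles_swap (D := D) ▸ hx)
  parent x hx := by
    simpa only [Forwards, carriers, innerVerts_comm H t s] using!
      h.parent x (innerVerts_comm H s t ▸ hx)
  transit x hx := by
    simpa only [Forwards, carriers, innerVerts_comm H t s] using!
      h.transit x (innerVerts_comm H s t ▸ hx)

theorem Extends.forwards (E : D.Extends D₀ H₀ s₀ t₀ H s t)
    (hτ : ∀ y ∈ innerVerts H₀ s₀ t₀, τ y = τ₀ y ∨ τ₀ y = y)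
    (h : D₀.Forwards τ₀ H₀ s₀ t₀ w x) : D.Forwards τ H s t w x := by
  obtain ⟨P, hP, hPc, hw, hx, hcar⟩ := h
  refine ⟨P, hP.trans E.le, hPc, hw, hx, fun y hy => ?_⟩
  rcases hcar hy with hyw | ⟨hyi, hpar | htr⟩
  · exact .inl hyw
  · exact .inr ⟨E.inner_subset hyi, .inl ((E.agreesOn.parent hyi).trans hpar)⟩
  · rcases hτ y hyi with hyτ | hyτ
    · exact .inr ⟨E.inner_subset hyi, .inr (hyτ.trans htr)⟩
    · exact .inl (hyτ.symm.trans htr)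

theorem Extends.forwards_parent (E : D.Extends D₀ H₀ s₀ t₀ H s t)
    (hτ : ∀ y ∈ innerVerts H₀ s₀ t₀, τ y = τ₀ y ∨ τ₀ y = y) (h : D₀.Routes τ₀ H₀ s₀ t₀ z)
    (hx : x ∈ innerVerts H₀ s₀ t₀) : D.Forwards τ H s t (D.parent x) x := by
  rw [E.agreesOn.parent hx]
  exact E.forwards hτ (h.parent x hx)

theorem forwards_self (hx : x ∈ H.verts) : D.Forwards τ H s t x x :=
  ⟨G.singletonSubgraph x, (singletonSubgraph_le_iff _ _).2 hx, Subgraph.singletonSubgraph_connected,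
    rfl, rfl, fun _ hy => .inl hy⟩

theorem Routes.parallel (hA : DA.Routes τA A s t z) (hB : DB.Routes τB B s t z)
    (EA : D.Extends DA A s t (A ⊔ B) s t) (EB : D.Extends DB B s t (A ⊔ B) s t)
    (hτA : Set.EqOn τ τA (innerVerts A s t)) (hτB : Set.EqOn τ τB (innerVerts B s t)) :
    D.Routes τ (A ⊔ B) s t z := by
  have hτA' := fun y (hy : y ∈ innerVerts A s t) => Or.inl (b := τA y = y) (hτA hy)
  have hτB' := fun y (hy : y ∈ innerVerts B s t) => Or.inl (b := τB y = y) (hτB hy)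
  refine ⟨hA.describes.parallel hB.describes EA EB, fun x hx => ?_, ?_, ?_⟩
  · rcases innerVerts_sup_parallel.subset hx.1 with hxi | hxi
    · rw [EA.agreesOn.parent hxi, hA.parent_root x ((EA.mem_middles hxi).1 hx)]
    · rw [EB.agreesOn.parent hxi, hB.parent_root x ((EB.mem_middles hxi).1 hx)]
  · rw [innerVerts_sup_parallel]
    exact fun x hx => hx.elim (EA.forwards_parent hτA' hA) (EB.forwards_parent hτB' hB)
  · rw [innerVerts_sup_parallel]
    rintro x (hx | hx)
    · exact hτA hx ▸ EA.forwards hτA' (hA.transit x hx)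
    · exact hτB hx ▸ EB.forwards hτB' (hB.transit x hx)

/-- The two parts receive the label of `m` through their terminal `m`, and `m` receives the label
of `s` along the free link `P`, whose inner vertices now carry that label. -/
theorem Routes.series (hA : DA.Routes τA A s m m) (hB : DB.Routes τB B m t m)
    (hverts : A.verts ∩ B.verts = {m}) (EA : D.Extends DA A s m (A ⊔ B) s t)
    (EB : D.Extends DB B m t (A ⊔ B) s t) (hm : m ∈ D.middles (A ⊔ B) s t s t)
    (hpm : D.parent m = s) (hdepth : ∀ x ≠ m, D.depth m < D.depth x)
    (hP : IsFreeLink τA A s m P) (hτm : τ m = m) (hτP : ∀ y ∈ innerVerts P s m, τ y = s)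
    (hτA : Set.EqOn τ τA (innerVerts A s m \ P.verts))
    (hτB : Set.EqOn τ τB (innerVerts B m t)) :
    D.Routes τ (A ⊔ B) s t s := by
  have hinner := innerVerts_sup_series hverts hA.describes.source_mem hB.describes.sink_mem
    hA.describes.ne hB.describes.ne
  have hτA' : ∀ y ∈ innerVerts A s m, τ y = τA y ∨ τA y = y := fun y hy =>
    (em (y ∈ P.verts)).elim (fun hyP => .inr (hP.idle y ⟨hyP, hy.2⟩))
      fun hyP => .inl (hτA ⟨hy, hyP⟩)
  have hτB' := fun y (hy : y ∈ innerVerts B m t) => Or.inl (b := τB y = y) (hτB hy)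
  have hsource : ∀ x ∈ P.verts, D.Forwards τ (A ⊔ B) s t s x := fun x hx => by
    refine ⟨P, hP.le.trans le_sup_left, hP.connected, hP.source_mem, hx, fun y hy => ?_⟩
    by_cases hys : y = s
    · exact .inl hys
    by_cases hym : y = m
    · exact .inr ⟨hym ▸ hm.1, .inl (hym ▸ hpm)⟩
    · have hne : y ∉ ({s, m} : Set V) := not_or.2 ⟨hys, hym⟩
      exact .inr ⟨EA.inner_subset ⟨hP.le.1 hy, hne⟩, .inr (hτP y ⟨hy, hne⟩)⟩
  refine ⟨hA.describes.series hB.describes hverts EA EB hm ?_ ?_ hdepth, fun x hx => ?_, ?_, ?_⟩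
  · exact fun x hx => (EA.agreesOn.parent hx.1).trans (hA.parent_root x hx)
  · exact fun x hx => (EB.agreesOn.parent hx.1).trans (hB.parent_root x hx)
  · rw [hA.describes.eq_of_mem_middles_series hB.describes hverts EA EB hx, hpm]
  · rw [hinner]
    rintro x (rfl | hx | hx)
    exacts [hpm.symm ▸ hsource x hP.sink_mem, EA.forwards_parent hτA' hA hx,
      EB.forwards_parent hτB' hB hx]
  · rw [hinner]
    rintro x (rfl | hx | hx)
    · exact hτm.symm ▸ forwards_self hm.1.1
    · by_cases hxP : x ∈ P.verts
      · exact hτP x ⟨hxP, hx.2⟩ ▸ hsource x hxP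
      · exact hτA ⟨hx, hxP⟩ ▸ EA.forwards hτA' (hA.transit x hx)
    · exact hτB hx ▸ EB.forwards hτB' (hB.transit x hx)

theorem IsFreeLink.swap (h : IsFreeLink τ H s t P) : IsFreeLink τ H t s P where
  le := h.le
  connected := h.connected
  source_mem := h.sink_mem
  sink_mem := h.source_mem
  idle y hy := h.idle y (innerVerts_comm P s t ▸ hy)

theorem IsFreeLink.congr (h : IsFreeLink τ₀ H₀ s t P) (hle : H₀ ≤ H)
    (hτ : Set.EqOn τ τ₀ (innerVerts P s t)) : IsFreeLink τ H s t P where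
  le := h.le.trans hle
  connected := h.connected
  source_mem := h.source_mem
  sink_mem := h.sink_mem
  idle y hy := (hτ hy).trans (h.idle y hy)

theorem IsFreeLink.series (hP : IsFreeLink τ H s m P) (hQ : IsFreeLink τ H m t Q)
    (hm : τ m = m) : IsFreeLink τ H s t (P ⊔ Q) where
  le := sup_le hP.le hQ.le
  connected := Subgraph.connected_sup hP.connected.preconnected hQ.connected.preconnected
    ⟨m, hP.sink_mem, hQ.source_mem⟩
  source_mem := .inl hP.source_mem
  sink_mem := .inr hQ.sink_mem
  idle := by
    rintro y ⟨hy, hne⟩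
    by_cases hym : y = m
    · rw [hym, hm]
    · exact hy.elim (fun hy => hP.idle y ⟨hy, fun h => h.elim (fun h => hne (.inl h)) hym⟩)
        fun hy => hQ.idle y ⟨hy, fun h => h.elim hym fun h => hne (.inr h)⟩

theorem exists_extends_series (hA : DA.Describes A s m) (hB : DB.Describes B m t)
    (hverts : A.verts ∩ B.verts = {m}) (hBA : Disjoint (innerVerts B m t) A.verts) :
    ∃ D : Decomposition V, D.Extends DA A s m (A ⊔ B) s t ∧ D.Extends DB B m t (A ⊔ B) s t ∧
      m ∈ D.middles (A ⊔ B) s t s t ∧ D.parent m = s ∧ ∀ x ≠ m, D.depth m < D.depth x := by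
  classical
  have hinner := innerVerts_sup_series hverts hA.source_mem hB.sink_mem hA.ne hB.ne
  have hmA : innerVerts A s m ⊆ {m}ᶜ := fun x hx hxm => hx.2 (.inr hxm)
  have hmB : innerVerts B m t ⊆ {m}ᶜ := fun x hx hxm => hx.2 (.inl hxm)
  refine ⟨(glue A.verts DA DB).insertMiddle s m t,
    ⟨le_sup_left, ?_, agreesOn_insertMiddle.trans (agreesOn_glue_left Set.sdiff_subset) hmA⟩,
    ⟨le_sup_right, ?_, agreesOn_insertMiddle.trans (agreesOn_glue_right hBA) hmB⟩,
    ⟨hinner ▸ .inl rfl, by simp [insertMiddle], by simp [insertMiddle]⟩, by simp [insertMiddle],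
    fun _ => depth_insertMiddle_lt⟩
  all_goals rw [hinner]
  exacts [Set.subset_union_left.trans (Set.subset_insert _ _),
    Set.subset_union_right.trans (Set.subset_insert _ _)]

theorem exists_transit_series (τA τB : V → V) (hP : P ≤ A)
    (hBA : Disjoint (innerVerts B m t) A.verts) :
    ∃ τ : V → V, τ m = m ∧ (∀ y ∈ innerVerts P s m, τ y = s) ∧
      Set.EqOn τ τA (innerVerts A s m \ P.verts) ∧ Set.EqOn τ τB (innerVerts B m t) := by
  classical
  refine ⟨Function.update (P.verts.piecewise (fun _ => s) (A.verts.piecewise τA τB)) m m,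
    Function.update_self _ _ _, fun y hy => ?_, fun y hy => ?_, fun y hy => ?_⟩
  · simp [hy.1, show y ≠ m from fun hym => hy.2 (.inr hym)]
  · simp [hy.1.1, hy.2, show y ≠ m from fun hym => hy.1.2 (.inr hym)]
  · have hyA := hBA.notMem_of_mem_left hy
    have hyP : y ∉ P.verts := fun hyP => hyA (hP.1 hyP)
    simp [hyA, hyP, show y ≠ m from fun hym => hy.2 (.inl hym)]

end Decomposition

/-- `H` has a decomposition tree, with root parent `z`, along which labels can be forwarded while
one link between the terminals stays free. -/
def HasScheme (H : G.Subgraph) (s t z : V) : Prop :=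
  ∃ D : Decomposition V, ∃ τ, D.Routes τ H s t z ∧ ∃ P, Decomposition.IsFreeLink τ H s t P

/-- The variant of `HasScheme` with two free links that meet at the terminals only. -/
def HasDoubleScheme (H : G.Subgraph) (s t z : V) : Prop :=
  ∃ D : Decomposition V, ∃ τ, D.Routes τ H s t z ∧ ∃ P Q, Decomposition.IsFreeLink τ H s t P ∧
    Decomposition.IsFreeLink τ H s t Q ∧ P.verts ∩ Q.verts ⊆ {s, t}

section Schemes

open Decomposition

variable {A B H H₁ H₂ : G.Subgraph} {s m t z : V}

theorem HasDoubleScheme.hasScheme (h : HasDoubleScheme H s t z) : HasScheme H s t z := by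
  obtain ⟨D, τ, hD, P, -, hP, -⟩ := h
  exact ⟨D, τ, hD, P, hP⟩

theorem HasScheme.swap (h : HasScheme H s t z) : HasScheme H t s z := by
  obtain ⟨D, τ, hD, P, hP⟩ := h
  exact ⟨D.swap, τ, hD.swap, P, hP.swap⟩

theorem HasDoubleScheme.swap (h : HasDoubleScheme H s t z) : HasDoubleScheme H t s z := by
  obtain ⟨D, τ, hD, P, Q, hP, hQ, hPQ⟩ := h
  exact ⟨D.swap, τ, hD.swap, P, Q, hP.swap, hQ.swap, Set.pair_comm s t ▸ hPQ⟩

theorem hasDoubleScheme_subgraphOfAdj (h : G.Adj s t) (z : V) :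
    HasDoubleScheme (G.subgraphOfAdj h) s t z := by
  have hempty : innerVerts (G.subgraphOfAdj h) s t = ∅ := Set.sdiff_self
  have hlink : IsFreeLink id (G.subgraphOfAdj h) s t (G.subgraphOfAdj h) :=
    ⟨le_rfl, Subgraph.subgraphOfAdj_connected h, .inl rfl, .inr rfl, fun _ _ => rfl⟩
  refine ⟨⟨id, id, id, fun _ => 0⟩, id, ⟨⟨h.ne, hlink.connected, hlink.source_mem, hlink.sink_mem,
    ?_, fun u v huv => ?_, ?_, ?_⟩, fun x hx => (hempty.subset hx.1).elim, ?_, ?_⟩,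
    _, _, hlink, hlink, Set.inter_subset_left⟩
  rotate_left
  · rw [subgraphOfAdj_adj, Sym2.eq_iff] at huv
    exact huv.elim (fun h => .inl ⟨h.1.symm, h.2.symm⟩) fun h => .inr (.inl ⟨h.2.symm, h.1.symm⟩)
  all_goals exact fun x hx => (hempty.subset hx).elim

theorem HasScheme.parallel (hA : HasScheme A s t z) (hB : HasScheme B s t z)
    (hverts : A.verts ∩ B.verts = {s, t}) : HasDoubleScheme (A ⊔ B) s t z := by
  classical
  obtain ⟨DA, τA, hA, P, hP⟩ := hA
  obtain ⟨DB, τB, hB, Q, hQ⟩ := hB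
  have hdisj : Disjoint (innerVerts B s t) A.verts :=
    Set.disjoint_left.2 fun x hx hxA => hx.2 (hverts.subset ⟨hxA, hx.1⟩)
  have hτA : Set.EqOn (A.verts.piecewise τA τB) τA (innerVerts A s t) :=
    (A.verts.piecewise_eqOn _ _).mono Set.sdiff_subset
  have hτB : Set.EqOn (A.verts.piecewise τA τB) τB (innerVerts B s t) :=
    (A.verts.piecewise_eqOn_compl _ _).mono hdisj.subset_compl_right
  refine ⟨glue A.verts DA DB, A.verts.piecewise τA τB, hA.parallel hB
      ⟨le_sup_left, ?_, agreesOn_glue_left Set.sdiff_subset⟩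
      ⟨le_sup_right, ?_, agreesOn_glue_right hdisj⟩ hτA hτB, P, Q,
    hP.congr le_sup_left (hτA.mono (Set.sdiff_subset_sdiff_left hP.le.1)),
    hQ.congr le_sup_right (hτB.mono (Set.sdiff_subset_sdiff_left hQ.le.1)),
    hverts ▸ Set.inter_subset_inter hP.le.1 hQ.le.1⟩
  all_goals rw [innerVerts_sup_parallel]
  exacts [Set.subset_union_left, Set.subset_union_right]

theorem HasDoubleScheme.series (hA : HasDoubleScheme A s m m) (hB : HasScheme B m t m)
    (hverts : A.verts ∩ B.verts = {m}) : HasScheme (A ⊔ B) s t s := by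
  obtain ⟨DA, τA, hA, P, R, hP, hR, hPR⟩ := hA
  obtain ⟨DB, τB, hB, Q, hQ⟩ := hB
  have hBA : Disjoint (innerVerts B m t) A.verts :=
    Set.disjoint_left.2 fun x hx hxA => hx.2 (.inl (hverts.subset ⟨hxA, hx.1⟩))
  obtain ⟨D, EA, EB, hm, hparent, hdepth⟩ :=
    exists_extends_series hA.describes hB.describes hverts hBA
  obtain ⟨τ, hτm, hτP, hτA, hτB⟩ := exists_transit_series τA τB hP.le hBA
  have hR' : IsFreeLink τ (A ⊔ B) s m R := hR.congr le_sup_left fun y hy =>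
    hτA ⟨⟨hR.le.1 hy.1, hy.2⟩, fun hyP => hy.2 (hPR ⟨hyP, hy.1⟩)⟩
  have hQ' : IsFreeLink τ (A ⊔ B) m t Q :=
    hQ.congr le_sup_right (hτB.mono (Set.sdiff_subset_sdiff_left hQ.le.1))
  exact ⟨D, τ, hA.series hB hverts EA EB hm hparent hdepth hP hτm hτP hτA hτB, R ⊔ Q,
    hR'.series hQ' hτm⟩

/-- `H` has a scheme and can be put in series before every part that has one. -/
structure Prependable (H : G.Subgraph) (s t : V) : Prop where
  hasScheme : HasScheme H s t s
  prepend : ∀ ⦃B : G.Subgraph⦄ ⦃r : V⦄, HasScheme B t r t → H.verts ∩ B.verts = {t} →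
    HasScheme (H ⊔ B) s r s

theorem HasDoubleScheme.prependable (hs : HasDoubleScheme H s t s) (ht : HasDoubleScheme H s t t) :
    Prependable H s t :=
  ⟨hs.hasScheme, fun _ _ => ht.series⟩

theorem Prependable.series (h₁ : Prependable H₁ s m) (h₂ : Prependable H₂ m t)
    (ht : t ∈ H₂.verts) (hverts : H₁.verts ∩ H₂.verts = {m}) : Prependable (H₁ ⊔ H₂) s t where
  hasScheme := h₁.prepend h₂.hasScheme hverts
  prepend B r hB hBverts := by
    simp only [Set.ext_iff, Subgraph.verts_sup, Set.mem_inter_iff, Set.mem_union,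
      Set.mem_singleton_iff] at hverts hBverts
    rw [sup_assoc]
    refine h₁.prepend (h₂.prepend hB ?_) ?_
    all_goals
      ext x
      simp only [Subgraph.verts_sup, Set.mem_inter_iff, Set.mem_union, Set.mem_singleton_iff]
      grind

theorem IsTwoTerminalSP.prependable (h : IsTwoTerminalSP G H s t) :
    Prependable H s t ∧ Prependable H t s := by
  have of_double : ∀ {H : G.Subgraph} {s t : V}, HasDoubleScheme H s t s →
      HasDoubleScheme H s t t → Prependable H s t ∧ Prependable H t s :=
    fun hs ht => ⟨hs.prependable ht, ht.swap.prependable hs.swap⟩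
  induction h with
  | edge h =>
    exact of_double (hasDoubleScheme_subgraphOfAdj h _) (hasDoubleScheme_subgraphOfAdj h _)
  | series h₁ h₂ hverts ih₁ ih₂ =>
    refine ⟨ih₁.1.series ih₂.1 h₂.sink_mem hverts, ?_⟩
    rw [sup_comm]
    exact ih₂.2.series ih₁.2 h₁.source_mem (Set.inter_comm _ _ ▸ hverts)
  | parallel _ _ hverts _ ih₁ ih₂ =>
    exact of_double (ih₁.1.hasScheme.parallel ih₂.1.hasScheme hverts)
      (ih₁.2.hasScheme.swap.parallel ih₂.2.hasScheme.swap hverts)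

end Schemes

/-! ### Certificates and their local verification -/

/-- The vertices whose labels a certificate holds: the vertex itself, its parent, the vertex whose
label it merely forwards, the two terminals, and two middles between the terminals. -/
inductive Role
  | own
  | parent
  | transit
  | source
  | sink
  | root₁
  | root₂

/-- The position of a vertex in a decomposition tree.  Vertices are denoted by their identifiers. -/
@[ext]
structure VertexLabel where
  ident : ℕ
  left : ℕ
  right : ℕ
  depth : ℕ

/-- A label, with an upper bound on the distance along which it has been forwarded. -/
@[ext]
structure Slot where
  label : VertexLabel
  dist : ℕ

instance : Nonempty Slot := ⟨⟨⟨0, 0, 0, 0⟩, 0⟩⟩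

/-- The content of a certificate, before its encoding by a bit string. -/
abbrev Certificate := Role → Slot

namespace Certificate

/-- The label that the holder of the certificate claims as its own. -/
def own (c : Certificate) : VertexLabel := (c .own).label

/-- `i` is the identifier of an inner vertex. -/
def IsInner (c : Certificate) (i : ℕ) : Prop :=
  i ≠ (c .source).label.ident ∧ i ≠ (c .sink).label.ident

/-- The label has the terminals of the whole graph as its pair. -/
def IsRootPair (c : Certificate) (l : VertexLabel) : Prop :=
  l.left = (c .source).label.ident ∧ l.right = (c .sink).label.ident

end Certificate

/-- What a vertex learns about its neighbours from their identifiers and certificates. -/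
def neighborViews {α : Type*} (G : SimpleGraph V) (ident : V → ℕ) (c : V → α) (v : V) :
    Set (ℕ × α) :=
  (fun w => (ident w, c w)) '' G.neighborSet v

/-- The label in slot `r` is the own label of the vertex, or has been forwarded by a neighbour. -/
def IsForwarded (c : Certificate) (N : Set (ℕ × Certificate)) (r : Role) : Prop :=
  (c r).label = c.own ∨ ∃ q ∈ N, ∃ r', (q.2 r').label = (c r).label ∧ (q.2 r').dist < (c r).dist

/-- The conditions of `Decomposition.Describes`, and the criterion for 2-connectivity, as a vertex
with identifier `i` reads them off the labels. -/
structure LocallyDescribes (i : ℕ) (c : Certificate) (N : Set (ℕ × Certificate)) : Prop where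
  ne : (c .source).label.ident ≠ (c .sink).label.ident
  root_or_child : c.IsInner i → c.IsRootPair c.own ∨
    (c.IsInner (c .parent).label.ident ∧ (c .parent).label.depth < c.own.depth ∧
      ((c.own.left = (c .parent).label.left ∧ c.own.right = (c .parent).label.ident) ∨
        (c.own.left = (c .parent).label.ident ∧ c.own.right = (c .parent).label.right)))
  edge : ∀ q ∈ N, (i = (c .source).label.ident ∧ q.1 = (c .sink).label.ident) ∨
    (i = (c .sink).label.ident ∧ q.1 = (c .source).label.ident) ∨
    (c.IsInner q.1 ∧ (i = q.2.own.left ∨ i = q.2.own.right)) ∨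
    (c.IsInner i ∧ (q.1 = c.own.left ∨ q.1 = c.own.right))
  left : c.IsInner i → ∃ q ∈ N, q.1 = c.own.left ∨ (c.IsInner q.1 ∧ q.2.own.right = i)
  right : c.IsInner i → ∃ q ∈ N, q.1 = c.own.right ∨ (c.IsInner q.1 ∧ q.2.own.left = i)
  root : i = (c .source).label.ident → (∃ q ∈ N, q.1 = (c .sink).label.ident) ∨
    ((c .root₁).label.ident ≠ (c .root₂).label.ident ∧
      (c.IsInner (c .root₁).label.ident ∧ c.IsRootPair (c .root₁).label) ∧
      (c.IsInner (c .root₂).label.ident ∧ c.IsRootPair (c .root₂).label))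

/-- The conditions checked by a vertex with identifier `i` and certificate `c`, whose neighbours
have the identifiers and certificates in `N`. -/
structure LocallyValid (i : ℕ) (c : Certificate) (N : Set (ℕ × Certificate)) : Prop where
  own_ident : c.own.ident = i
  forwarded : ∀ r, IsForwarded c N r
  source_eq : ∀ q ∈ N, (q.2 .source).label = (c .source).label
  sink_eq : ∀ q ∈ N, (q.2 .sink).label = (c .sink).label
  describes : LocallyDescribes i c N

/-- The labels on the vertices are those of the decomposition tree `D` with terminals `s` and `t`,
and the slot `r` of `v` holds the label of `target v r`. -/
structure Encodes (ident : V → ℕ) (c : V → Certificate) (target : V → Role → V)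
    (D : Decomposition V) (G : SimpleGraph V) (s t : V) : Prop where
  label v r : (c v r).label = (c (target v r)).own
  own_ident v : (c v).own.ident = ident v
  own_depth v : (c v).own.depth = D.depth v
  own_left : ∀ v ∈ innerVerts (⊤ : G.Subgraph) s t, (c v).own.left = ident (D.left v)
  own_right : ∀ v ∈ innerVerts (⊤ : G.Subgraph) s t, (c v).own.right = ident (D.right v)
  target_source v : target v .source = s
  target_sink v : target v .sink = t
  target_parent : ∀ v ∈ innerVerts (⊤ : G.Subgraph) s t, target v .parent = D.parent v

theorem mem_innerVerts_top {s t x : V} : x ∈ innerVerts (⊤ : G.Subgraph) s t ↔ x ≠ s ∧ x ≠ t := by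
  simp [innerVerts]

namespace Encodes

variable {ident : V → ℕ} {c : V → Certificate} {target : V → Role → V} {D : Decomposition V}
  {s t : V}

theorem ident_slot (E : Encodes ident c target D G s t) (v : V) (r : Role) :
    (c v r).label.ident = ident (target v r) := by
  rw [E.label, E.own_ident]

theorem isInner_iff (E : Encodes ident c target D G s t) (hident : Function.Injective ident)
    (v x : V) : (c v).IsInner (ident x) ↔ x ∈ innerVerts (⊤ : G.Subgraph) s t := by
  rw [Certificate.IsInner, E.ident_slot, E.ident_slot, E.target_source, E.target_sink,
    hident.ne_iff, hident.ne_iff, mem_innerVerts_top]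

theorem isRootPair_iff (E : Encodes ident c target D G s t) (hident : Function.Injective ident)
    (v : V) {x : V} (hx : x ∈ innerVerts (⊤ : G.Subgraph) s t) :
    (c v).IsRootPair (c x).own ↔ D.left x = s ∧ D.right x = t := by
  rw [Certificate.IsRootPair, E.ident_slot, E.ident_slot, E.target_source, E.target_sink,
    E.own_left x hx, E.own_right x hx, hident.eq_iff, hident.eq_iff]

theorem root_or_child_iff (E : Encodes ident c target D G s t) (hident : Function.Injective ident)
    {x : V} (hx : x ∈ innerVerts (⊤ : G.Subgraph) s t) :
    ((c x).IsRootPair (c x).own ∨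
      ((c x).IsInner (c x .parent).label.ident ∧ (c x .parent).label.depth < (c x).own.depth ∧
        (((c x).own.left = (c x .parent).label.left ∧
          (c x).own.right = (c x .parent).label.ident) ∨
        ((c x).own.left = (c x .parent).label.ident ∧
          (c x).own.right = (c x .parent).label.right)))) ↔
    x ∈ D.middles (⊤ : G.Subgraph) s t s t ∨
      D.IsChild (⊤ : G.Subgraph) s t x (D.parent x) := by
  rw [E.isRootPair_iff hident x hx, E.label, E.target_parent x hx, E.own_ident,
    E.isInner_iff hident, E.own_depth, E.own_depth, E.own_left x hx, E.own_right x hx]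
  refine or_congr (and_iff_right hx).symm ⟨fun ⟨hp, hd, hpair⟩ => ?_, fun h => ?_⟩
  · rw [E.own_left _ hp, E.own_right _ hp] at hpair
    simp only [hident.eq_iff] at hpair
    exact ⟨hx, hp, rfl, hd, hpair⟩
  · refine ⟨h.inner_parent, h.depth_lt, ?_⟩
    rw [E.own_left _ h.inner_parent, E.own_right _ h.inner_parent]
    simpa only [hident.eq_iff] using h.pair

theorem isEnd_iff (E : Encodes ident c target D G s t) (hident : Function.Injective ident)
    (v x y : V) :
    (c v).IsInner (ident y) ∧ (ident x = (c y).own.left ∨ ident x = (c y).own.right) ↔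
      D.IsEnd (⊤ : G.Subgraph) s t x y := by
  rw [E.isInner_iff hident]
  refine and_congr_right fun hy => ?_
  rw [E.own_left y hy, E.own_right y hy, hident.eq_iff, hident.eq_iff]

theorem linkedLeft_iff (E : Encodes ident c target D G s t) (hident : Function.Injective ident)
    {x : V} (hx : x ∈ innerVerts (⊤ : G.Subgraph) s t) :
    (∃ q ∈ neighborViews G ident c x,
      q.1 = (c x).own.left ∨ ((c x).IsInner q.1 ∧ q.2.own.right = ident x)) ↔
    D.LinkedLeft (⊤ : G.Subgraph) s t x (D.left x) := by
  rw [neighborViews, Set.exists_mem_image]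
  refine exists_congr fun y => and_congr_right fun _ => ?_
  rw [E.own_left x hx, hident.eq_iff, E.isInner_iff hident]
  refine or_congr_right (and_congr_right fun hy => ?_)
  rw [E.own_right y hy, hident.eq_iff]

theorem linkedRight_iff (E : Encodes ident c target D G s t) (hident : Function.Injective ident)
    {x : V} (hx : x ∈ innerVerts (⊤ : G.Subgraph) s t) :
    (∃ q ∈ neighborViews G ident c x,
      q.1 = (c x).own.right ∨ ((c x).IsInner q.1 ∧ q.2.own.left = ident x)) ↔
    D.LinkedRight (⊤ : G.Subgraph) s t x (D.right x) := by
  rw [neighborViews, Set.exists_mem_image]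
  refine exists_congr fun y => and_congr_right fun _ => ?_
  rw [E.own_right x hx, hident.eq_iff, E.isInner_iff hident]
  refine or_congr_right (and_congr_right fun hy => ?_)
  rw [E.own_left y hy, hident.eq_iff]

theorem root_iff (E : Encodes ident c target D G s t) (hident : Function.Injective ident)
    (v : V) (r : Role) :
    ((c v).IsInner (c v r).label.ident ∧ (c v).IsRootPair (c v r).label) ↔
      target v r ∈ D.middles (⊤ : G.Subgraph) s t s t := by
  rw [E.label, E.own_ident, E.isInner_iff hident]
  exact and_congr_right fun hx => E.isRootPair_iff hident v hx

theorem edge_iff (E : Encodes ident c target D G s t) (hident : Function.Injective ident) (v : V) :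
    (∀ q ∈ neighborViews G ident c v,
      (ident v = (c v .source).label.ident ∧ q.1 = (c v .sink).label.ident) ∨
      (ident v = (c v .sink).label.ident ∧ q.1 = (c v .source).label.ident) ∨
      ((c v).IsInner q.1 ∧ (ident v = q.2.own.left ∨ ident v = q.2.own.right)) ∨
      ((c v).IsInner (ident v) ∧ (q.1 = (c v).own.left ∨ q.1 = (c v).own.right))) ↔
    ∀ w, G.Adj v w → (v = s ∧ w = t) ∨ (v = t ∧ w = s) ∨
      D.IsEnd (⊤ : G.Subgraph) s t v w ∨ D.IsEnd (⊤ : G.Subgraph) s t w v := by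
  rw [neighborViews, Set.forall_mem_image]
  refine forall_congr' fun w => imp_congr_right fun _ => ?_
  rw [E.isEnd_iff hident, E.isEnd_iff hident, E.ident_slot, E.ident_slot, E.target_source,
    E.target_sink]
  simp only [hident.eq_iff]

theorem terminal_criterion_iff (E : Encodes ident c target D G s t)
    (hident : Function.Injective ident) :
    ((∃ q ∈ neighborViews G ident c s, q.1 = (c s .sink).label.ident) ∨
      ((c s .root₁).label.ident ≠ (c s .root₂).label.ident ∧
        ((c s).IsInner (c s .root₁).label.ident ∧ (c s).IsRootPair (c s .root₁).label) ∧
        ((c s).IsInner (c s .root₂).label.ident ∧ (c s).IsRootPair (c s .root₂).label))) ↔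
    G.Adj s t ∨ (target s .root₁ ≠ target s .root₂ ∧
      target s .root₁ ∈ D.middles (⊤ : G.Subgraph) s t s t ∧
      target s .root₂ ∈ D.middles (⊤ : G.Subgraph) s t s t) := by
  rw [E.root_iff hident, E.root_iff hident, E.ident_slot, E.ident_slot, E.ident_slot,
    E.target_sink, hident.ne_iff, neighborViews, Set.exists_mem_image]
  simp only [hident.eq_iff, exists_eq_right, mem_neighborSet]

theorem locallyDescribes_iff (E : Encodes ident c target D G s t)
    (hident : Function.Injective ident) (hG : G.Connected) :
    (∀ v, LocallyDescribes (ident v) (c v) (neighborViews G ident c v)) ↔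
      D.Describes (⊤ : G.Subgraph) s t ∧ (G.Adj s t ∨
        (target s .root₁ ≠ target s .root₂ ∧
          target s .root₁ ∈ D.middles (⊤ : G.Subgraph) s t s t ∧
          target s .root₂ ∈ D.middles (⊤ : G.Subgraph) s t s t)) := by
  have source_ident v : (c v .source).label.ident = ident s := by
    rw [E.ident_slot, E.target_source]
  have sink_ident v : (c v .sink).label.ident = ident t := by rw [E.ident_slot, E.target_sink]
  have inner_iff (v : V) := E.isInner_iff hident v v
  refine ⟨fun h => ⟨⟨?_, ⟨Subgraph.topIso.connected_iff.2 hG⟩, trivial, trivial,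
    fun x hx => ?_, fun v => ?_, fun x hx => ?_, fun x hx => ?_⟩, ?_⟩, fun ⟨hD, hroot⟩ v =>
    ⟨?_, fun hx => ?_, ?_, fun hx => ?_, fun hx => ?_, fun hv => ?_⟩⟩
  · exact fun hst => (h s).ne (by rw [source_ident, sink_ident, hst])
  · exact (E.root_or_child_iff hident hx).1 ((h x).root_or_child ((inner_iff x).2 hx))
  · exact (E.edge_iff hident v).1 (h v).edge
  · exact (E.linkedLeft_iff hident hx).1 ((h x).left ((inner_iff x).2 hx))
  · exact (E.linkedRight_iff hident hx).1 ((h x).right ((inner_iff x).2 hx))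
  · exact (E.terminal_criterion_iff hident).1 ((h s).root (source_ident s).symm)
  · rw [source_ident, sink_ident, hident.ne_iff]
    exact hD.ne
  · have hx := (inner_iff v).1 hx
    exact (E.root_or_child_iff hident hx).2 (hD.root_or_child v hx)
  · exact (E.edge_iff hident v).2 (hD.edge v)
  · have hx := (inner_iff v).1 hx
    exact (E.linkedLeft_iff hident hx).2 (hD.left v hx)
  · have hx := (inner_iff v).1 hx
    exact (E.linkedRight_iff hident hx).2 (hD.right v hx)
  · obtain rfl : v = s := hident (hv.trans (source_ident v))
    exact (E.terminal_criterion_iff hident).2 hroot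

end Encodes

/-! ### Soundness -/

section Soundness

variable {ident : V → ℕ} {c : V → Certificate}

theorem exists_own_eq (h : ∀ v r, IsForwarded (c v) (neighborViews G ident c v) r) (v : V)
    (r : Role) : ∃ w, (c v r).label = (c w).own := by
  induction hd : (c v r).dist using Nat.strong_induction_on generalizing v r with
  | _ d ih =>
    subst hd
    rcases h v r with hown | ⟨_, ⟨w, -, rfl⟩, r', hlabel, hlt⟩
    · exact ⟨v, hown⟩
    · rw [← hlabel]
      exact ih _ hlt w r' rfl

theorem label_eq_of_preconnected (hG : G.Preconnected) {r : Role}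
    (h : ∀ v, ∀ q ∈ neighborViews G ident c v, (q.2 r).label = (c v r).label) (u v : V) :
    (c u r).label = (c v r).label := by
  obtain ⟨p⟩ := hG u v
  induction p with
  | nil => rfl
  | @cons u w _ huw _ ih => exact (h u _ ⟨w, huw, rfl⟩).symm.trans ih

theorem own_terminals_mem_range (hG : G.Preconnected)
    (h : ∀ v, LocallyValid (ident v) (c v) (neighborViews G ident c v)) {x : V}
    (hx : (c x).IsInner (ident x)) :
    (c x).own.left ∈ Set.range ident ∧ (c x).own.right ∈ Set.range ident := by
  have mem_range (v : V) (r : Role) : (c v r).label.ident ∈ Set.range ident := by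
    obtain ⟨w, hw⟩ := exists_own_eq (fun v => (h v).forwarded) v r
    exact ⟨w, by rw [hw, (h w).own_ident]⟩
  induction hd : (c x).own.depth using Nat.strong_induction_on generalizing x with
  | _ d ih =>
    subst hd
    rcases (h x).describes.root_or_child hx with ⟨hl, hr⟩ | ⟨hinner, hlt, hpair⟩
    · rw [hl, hr]
      exact ⟨mem_range x _, mem_range x _⟩
    obtain ⟨p, hp⟩ := exists_own_eq (fun v => (h v).forwarded) x .parent
    have hpinner : (c p).IsInner (ident p) := by
      rw [hp, (h p).own_ident] at hinner
      rwa [Certificate.IsInner,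
        label_eq_of_preconnected hG (fun v => (h v).source_eq) p x,
        label_eq_of_preconnected hG (fun v => (h v).sink_eq) p x]
    rw [hp] at hlt
    obtain ⟨hpl, hpr⟩ := ih _ hlt hpinner rfl
    have hpi := mem_range x .parent
    rw [hp] at hpair hpi
    rcases hpair with ⟨hl, hr⟩ | ⟨hl, hr⟩ <;> rw [hl, hr]
    exacts [⟨hpl, hpi⟩, ⟨hpi, hpr⟩]

theorem exists_encodes (hG : G.Connected) (hident : Function.Injective ident)
    (h : ∀ v, LocallyValid (ident v) (c v) (neighborViews G ident c v)) :
    ∃ target D s t, Encodes ident c target D G s t := by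
  have := hG.nonempty
  obtain ⟨v₀⟩ := hG.nonempty
  choose target htarget using exists_own_eq fun v => (h v).forwarded
  have target_eq {r : Role}
      (hr : ∀ v, ∀ q ∈ neighborViews G ident c v, (q.2 r).label = (c v r).label) (v : V) :
      target v r = target v₀ r := by
    apply hident
    rw [← (h _).own_ident, ← (h _).own_ident, ← htarget, ← htarget,
      label_eq_of_preconnected hG.preconnected hr v v₀]
  have target_source := target_eq fun v => (h v).source_eq
  have target_sink := target_eq fun v => (h v).sink_eq
  have own_mem {v : V} (hv : v ∈ innerVerts (⊤ : G.Subgraph) (target v₀ .source)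
      (target v₀ .sink)) := own_terminals_mem_range hG.preconnected h (x := v) <| by
    rw [mem_innerVerts_top] at hv
    rwa [Certificate.IsInner, htarget, htarget, (h _).own_ident, (h _).own_ident, target_source,
      target_sink, hident.ne_iff, hident.ne_iff]
  exact ⟨target, ⟨fun v => Function.invFun ident (c v).own.left,
    fun v => Function.invFun ident (c v).own.right, fun v => target v .parent,
    fun v => (c v).own.depth⟩, _, _,
    { label := htarget
      own_ident v := (h v).own_ident
      own_depth v := rfl
      own_left v hv := (Function.invFun_eq (own_mem hv).1).symm
      own_right v hv := (Function.invFun_eq (own_mem hv).2).symm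
      target_source := target_source
      target_sink := target_sink
      target_parent v _ := rfl }⟩

theorem isTwoConnected_and_isSeriesParallel [Finite V] (hG : G.Connected)
    (hident : Function.Injective ident)
    (h : ∀ v, LocallyValid (ident v) (c v) (neighborViews G ident c v)) :
    IsTwoConnected G ∧ IsSeriesParallel G := by
  obtain ⟨target, D, s, t, E⟩ := exists_encodes hG hident h
  obtain ⟨hD, hroot⟩ := (E.locallyDescribes_iff hident hG).1 fun v => (h v).describes
  exact ⟨hD.isTwoConnected_iff.2 (hroot.imp_right fun ⟨hne, h₁, h₂⟩ => ⟨_, h₁, _, h₂, hne⟩),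
    s, t, hD.isTwoTerminalSP⟩

end Soundness

/-! ### Completeness -/

theorem dist_le_card [Fintype V] (u v : V) : G.dist u v ≤ Fintype.card V := by
  by_cases h : G.Reachable u v
  · obtain ⟨p, hp, hlen⟩ := h.exists_path_of_dist
    exact hlen ▸ hp.length_lt.le
  · exact (dist_eq_zero_of_not_reachable h).trans_le (Nat.zero_le _)

theorem exists_adj_dist_lt {x w : V} (h : G.Reachable x w) (hne : x ≠ w) :
    ∃ y, G.Adj x y ∧ G.dist y w < G.dist x w := by
  obtain ⟨p, hp⟩ := h.exists_walk_length_eq_dist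
  cases p with
  | nil => exact absurd rfl hne
  | cons hadj p => exact ⟨_, hadj, hp ▸ Nat.lt_succ_of_le (dist_le p)⟩

/-- `d w` is the distance to `w` inside the set of all vertices that hold the label of `w`. -/
theorem exists_forwarding_dist [Fintype V] {ι : Type*} {target : V → ι → V}
    (h : ∀ v r, ∃ P : G.Subgraph, P.Connected ∧ target v r ∈ P.verts ∧ v ∈ P.verts ∧
      ∀ y ∈ P.verts, ∃ r', target y r' = target v r) :
    ∃ d : V → V → ℕ, (∀ w v, d w v ≤ Fintype.card V) ∧ ∀ v r, v ≠ target v r →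
      ∃ y, G.Adj v y ∧ ∃ r', target y r' = target v r ∧ d (target v r) y < d (target v r) v := by
  let K (w : V) : SimpleGraph V :=
    ((⊤ : G.Subgraph).induce {y | ∃ r, target y r = w}).spanningCoe
  refine ⟨fun w v => (K w).dist v w, fun _ _ => dist_le_card _ _, fun v r hne => ?_⟩
  obtain ⟨P, hP, hw, hv, hPK⟩ := h v r
  let toK : P.coe →g K (target v r) :=
    ⟨Subtype.val, fun {x y} hxy => ⟨hPK x x.2, hPK y y.2, P.adj_sub hxy⟩⟩
  have hreach : (K (target v r)).Reachable v (target v r) :=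
    (hP.preconnected ⟨v, hv⟩ ⟨_, hw⟩).map toK
  obtain ⟨y, ⟨-, ⟨r', hr'⟩, hvy⟩, hlt⟩ := exists_adj_dist_lt hreach hne
  exact ⟨y, hvy, r', hr', hlt⟩

namespace Decomposition

/-- The decomposition with each depth replaced by the number of smaller depths, which makes it at
most the number of vertices. -/
def compress [Fintype V] (D : Decomposition V) : Decomposition V where
  left := D.left
  right := D.right
  parent := D.parent
  depth v := Finset.card {y | D.depth y < D.depth v}

variable {D : Decomposition V} {τ : V → V} {H : G.Subgraph} {s t z : V}

theorem compress_depth_lt [Fintype V] {x y : V} (h : D.depth x < D.depth y) :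
    D.compress.depth x < D.compress.depth y := by
  refine Finset.card_lt_card <| (Finset.ssubset_iff_of_subset fun z hz => ?_).2
    ⟨x, by simpa using h, by simp⟩
  rw [Finset.mem_filter_univ] at hz ⊢
  exact hz.trans h

theorem Describes.compress [Fintype V] (h : D.Describes H s t) : D.compress.Describes H s t where
  __ := h
  root_or_child x hx := (h.root_or_child x hx).imp_right fun hp =>
    { hp with depth_lt := compress_depth_lt hp.depth_lt }

theorem Routes.compress [Fintype V] (h : D.Routes τ H s t z) : D.compress.Routes τ H s t z where
  __ := h
  describes := h.describes.compress

/-- The vertex whose label `v` holds in slot `r`. -/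
def target [DecidableEq V] (D : Decomposition V) (τ : V → V) (s t x₁ x₂ : V) (v : V) : Role → V
  | .own => v
  | .parent => if v = s ∨ v = t then v else D.parent v
  | .transit => if v = s ∨ v = t then v else τ v
  | .source => s
  | .sink => t
  | .root₁ => x₁
  | .root₂ => x₂

theorem exists_target_eq_of_mem_carriers [DecidableEq V] {x₁ x₂ w y : V}
    (hy : y ∈ D.carriers τ (⊤ : G.Subgraph) s t w) : ∃ r, D.target τ s t x₁ x₂ y r = w := by
  rcases hy with rfl | ⟨hinner, hp | hτ⟩
  · exact ⟨.own, rfl⟩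
  · exact ⟨.parent, (if_neg hinner.2).trans hp⟩
  · exact ⟨.transit, (if_neg hinner.2).trans hτ⟩

theorem Routes.exists_connected_target [DecidableEq V] (h : D.Routes τ (⊤ : G.Subgraph) s t z)
    (x₁ x₂ v : V) (r : Role) :
    ∃ P : G.Subgraph, P.Connected ∧ D.target τ s t x₁ x₂ v r ∈ P.verts ∧ v ∈ P.verts ∧
      ∀ y ∈ P.verts, ∃ r', D.target τ s t x₁ x₂ y r' = D.target τ s t x₁ x₂ v r := by
  have of_forwards {w : V} (hw : D.Forwards τ (⊤ : G.Subgraph) s t w v) :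
      ∃ P : G.Subgraph, P.Connected ∧ w ∈ P.verts ∧ v ∈ P.verts ∧
        ∀ y ∈ P.verts, ∃ r', D.target τ s t x₁ x₂ y r' = w := by
    obtain ⟨P, -, hP, hwP, hvP, hcar⟩ := hw
    exact ⟨P, hP, hwP, hvP, fun y hy => exists_target_eq_of_mem_carriers (hcar hy)⟩
  have self := of_forwards (forwards_self (D := D) (τ := τ) (s := s) (t := t) (Set.mem_univ v))
  cases r with
  | own => exact self
  | parent =>
    by_cases hv : v = s ∨ v = t
    · simpa only [target, if_pos hv] using self
    · simpa only [target, if_neg hv] using of_forwards (h.parent v ⟨trivial, hv⟩)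
  | transit =>
    by_cases hv : v = s ∨ v = t
    · simpa only [target, if_pos hv] using self
    · simpa only [target, if_neg hv] using of_forwards (h.transit v ⟨trivial, hv⟩)
  | source => exact ⟨⊤, h.describes.connected, trivial, trivial, fun _ _ => ⟨.source, rfl⟩⟩
  | sink => exact ⟨⊤, h.describes.connected, trivial, trivial, fun _ _ => ⟨.sink, rfl⟩⟩
  | root₁ => exact ⟨⊤, h.describes.connected, trivial, trivial, fun _ _ => ⟨.root₁, rfl⟩⟩
  | root₂ => exact ⟨⊤, h.describes.connected, trivial, trivial, fun _ _ => ⟨.root₂, rfl⟩⟩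

/-- The certificates that place the label of `target v r` in slot `r` of `v`, at distance
`d (target v r) v`. -/
def certificate (D : Decomposition V) (ident : V → ℕ) (target : V → Role → V) (d : V → V → ℕ)
    (v : V) : Certificate := fun r =>
  let x := target v r
  ⟨⟨ident x, ident (D.left x), ident (D.right x), D.depth x⟩, d x v⟩

theorem encodes_certificate [DecidableEq V] (D : Decomposition V) (τ : V → V) (G : SimpleGraph V)
    (s t x₁ x₂ : V) (ident : V → ℕ) (d : V → V → ℕ) :
    Encodes ident (D.certificate ident (D.target τ s t x₁ x₂) d) (D.target τ s t x₁ x₂) D G s t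
    where
  label _ _ := rfl
  own_ident _ := rfl
  own_depth _ := rfl
  own_left _ _ := rfl
  own_right _ _ := rfl
  target_source _ := rfl
  target_sink _ := rfl
  target_parent _ hv := if_neg hv.2

theorem isForwarded_certificate {ident : V → ℕ} {target : V → Role → V} {d : V → V → ℕ}
    (hown : ∀ v, target v .own = v)
    (hd : ∀ v r, v ≠ target v r → ∃ y, G.Adj v y ∧
      ∃ r', target y r' = target v r ∧ d (target v r) y < d (target v r) v) (v : V) (r : Role) :
    IsForwarded (D.certificate ident target d v)
      (neighborViews G ident (D.certificate ident target d) v) r := by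
  by_cases hv : v = target v r
  · left
    simp only [certificate, Certificate.own, hown, ← hv]
  · obtain ⟨y, hvy, r', hr', hlt⟩ := hd v r hv
    refine .inr ⟨_, ⟨y, hvy, rfl⟩, r', ?_⟩
    simpa only [certificate, hr', true_and]

end Decomposition

/-- The numbers of which a slot consists. -/
def Slot.toList (S : Slot) : List ℕ :=
  [S.label.ident, S.label.left, S.label.right, S.label.depth, S.dist]

theorem exists_locallyValid [Fintype V] (h2 : IsTwoConnected G) (hsp : IsSeriesParallel G)
    {ident : V → ℕ} (hident : Function.Injective ident) {N : ℕ} (hN : ∀ v, ident v ≤ N)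
    (hV : Fintype.card V ≤ N) :
    ∃ c : V → Certificate, (∀ v r, ∀ n ∈ (c v r).toList, n ≤ N) ∧
      ∀ v, LocallyValid (ident v) (c v) (neighborViews G ident c v) := by
  classical
  obtain ⟨s, t, hst⟩ := hsp
  obtain ⟨D₀, τ, hD₀, -⟩ := hst.prependable.1.hasScheme
  have hD := hD₀.compress
  obtain ⟨x₁, x₂, hroot⟩ : ∃ x₁ x₂, G.Adj s t ∨ (x₁ ≠ x₂ ∧
      x₁ ∈ D₀.compress.middles (⊤ : G.Subgraph) s t s t ∧
      x₂ ∈ D₀.compress.middles (⊤ : G.Subgraph) s t s t) := by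
    rcases hD.describes.isTwoConnected_iff.1 h2 with hadj | ⟨x₁, h₁, x₂, h₂, hne⟩
    exacts [⟨s, s, .inl hadj⟩, ⟨x₁, x₂, .inr ⟨hne, h₁, h₂⟩⟩]
  obtain ⟨d, hcard, hd⟩ := exists_forwarding_dist (hD.exists_connected_target x₁ x₂)
  have E := D₀.compress.encodes_certificate τ G s t x₁ x₂ ident d
  have hdescr := (E.locallyDescribes_iff hident h2.1).2 ⟨hD.describes, hroot⟩
  refine ⟨_, fun v r => ?_, fun v => ⟨rfl,
    Decomposition.isForwarded_certificate (fun _ => rfl) hd v, ?_, ?_, hdescr v⟩⟩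
  · simp only [Slot.toList, List.forall_mem_cons]
    exact ⟨hN _, hN _, hN _, (Finset.card_le_univ _).trans hV, (hcard _ _).trans hV, by simp⟩
  all_goals
    rintro _ ⟨w, -, rfl⟩
    rfl

/-! ### Encoding by bit strings -/

/-- A self-delimiting code for bit strings: each bit is announced by `true`, the end by `false`. -/
def delimit : List Bool → List Bool
  | [] => [false]
  | b :: l => true :: b :: delimit l

theorem delimit_append_inj {l l' r r' : List Bool} (h : delimit l ++ r = delimit l' ++ r') :
    l = l' ∧ r = r' := by
  induction l generalizing l' with
  | nil =>
    cases l' with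
    | nil => simpa [delimit] using h
    | cons b l' => simp [delimit] at h
  | cons b l ih =>
    cases l' with
    | nil => simp [delimit] at h
    | cons b' l' =>
      simp only [delimit, List.cons_append, List.cons.injEq, true_and] at h
      exact (ih h.2).imp_left fun hl => by rw [h.1, hl]

theorem length_delimit (l : List Bool) : (delimit l).length = 2 * l.length + 1 := by
  induction l with
  | nil => rfl
  | cons b l ih =>
    simp only [delimit, List.length_cons, ih]
    omega

theorem bits_injective : Function.Injective Nat.bits := fun m n h =>
  Nat.eq_of_testBit_eq fun i => by rw [Nat.testBit_eq_inth, Nat.testBit_eq_inth, h]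

/-- The code of a list of numbers: their self-delimiting binary expansions, one after another. -/
def encodeList (l : List ℕ) : List Bool := l.flatMap fun n => delimit n.bits

theorem encodeList_injective : Function.Injective encodeList := by
  intro l l' h
  induction l generalizing l' with
  | nil => cases l' with
    | nil => rfl
    | cons n l' => cases hn : n.bits <;> simp [encodeList, delimit, hn] at h
  | cons m l ih => cases l' with
    | nil => cases hm : m.bits <;> simp [encodeList, delimit, hm] at h
    | cons n l' =>
      rw [encodeList, encodeList, List.flatMap_cons, List.flatMap_cons] at h
      obtain ⟨hbits, hrest⟩ := delimit_append_inj h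
      rw [bits_injective hbits, ih hrest]

theorem length_encodeList_le {l : List ℕ} {N : ℕ} (h : ∀ n ∈ l, n ≤ N) :
    (encodeList l).length ≤ l.length * (2 * N.size + 1) := by
  rw [encodeList, List.length_flatMap, ← smul_eq_mul, ← List.length_map]
  refine List.sum_le_card_nsmul _ _ fun k hk => ?_
  obtain ⟨n, hn, rfl⟩ := List.mem_map.1 hk
  rw [length_delimit, Nat.size_eq_bits_len]
  gcongr
  exact Nat.size_le_size (h n hn)

namespace Certificate

/-- The bit string that represents a certificate. -/
def encode (c : Certificate) : List Bool :=
  encodeList <| [.own, .parent, .transit, .source, .sink, .root₁, .root₂].flatMap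
    fun r => (c r).toList

theorem encode_injective : Function.Injective encode := by
  intro c c' h
  have hslots := encodeList_injective h
  simp only [List.flatMap_cons, List.flatMap_nil, Slot.toList, List.cons_append,
    List.nil_append, List.cons.injEq] at hslots
  ext r <;> cases r <;> tauto

theorem length_encode_le {c : Certificate} {N : ℕ} (h : ∀ r, ∀ n ∈ (c r).toList, n ≤ N) :
    c.encode.length ≤ 35 * (2 * N.size + 1) := by
  refine length_encodeList_le fun n hn => ?_
  obtain ⟨r, -, hr⟩ := List.mem_flatMap.1 hn
  exact h r n hr

end Certificate

theorem certifiableWith_of_encoding {α : Type*} [Nonempty α] {encode : α → List Bool}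
    (hencode : Function.Injective encode) {k : ℕ} {C : GraphClass} {f : ℕ → ℕ}
    {Valid : ℕ → α → Set (ℕ × α) → Prop}
    (complete : ∀ (V : Type) [Fintype V] (G : SimpleGraph V), G.Connected → ∀ ident : V → ℕ,
      IsIdentifierAssignment k ident → C V G →
      ∃ c : V → α, (∀ v, (encode (c v)).length ≤ f (Fintype.card V)) ∧
        ∀ v, Valid (ident v) (c v) (neighborViews G ident c v))
    (sound : ∀ (V : Type) [Fintype V] (G : SimpleGraph V), G.Connected → ∀ ident : V → ℕ,
      IsIdentifierAssignment k ident → ∀ c : V → α,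
      (∀ v, Valid (ident v) (c v) (neighborViews G ident c v)) → C V G) :
    CertifiableWith k C f := by
  classical
  let decode := Function.invFun encode
  have decode_encode : Function.LeftInverse decode encode := Function.leftInverse_invFun hencode
  let A : Verifier := fun L =>
    decide (Valid L.ident (decode L.cert) (Prod.map id decode '' L.nbrs))
  have accepts_iff {V : Type} (G : SimpleGraph V) (ident : V → ℕ) (c : V → List Bool) :
      A.Accepts G ident c ↔
        ∀ v, Valid (ident v) (decode (c v)) (neighborViews G ident (decode ∘ c) v) :=
    forall_congr' fun v => by
      simp only [A, localView, decide_eq_true_iff, Set.image_image]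
      rfl
  refine ⟨A, fun V _ G hG ident hident => ⟨fun hC => ?_, fun hC c hc => hC ?_⟩⟩
  · obtain ⟨c, hlen, hc⟩ := complete V G hG ident hident hC
    refine ⟨encode ∘ c, hlen, (accepts_iff G ident _).2 ?_⟩
    rw [← Function.comp_assoc, decode_encode.comp_eq_id]
    simpa only [Function.comp_apply, decode_encode _] using! hc
  · exact sound V G hG ident hident _ ((accepts_iff G ident c).1 hc)

theorem size_le_logb (n : ℕ) : (n.size : ℝ) ≤ Real.logb 2 n + 1 :=
  calc (n.size : ℝ)
    _ ≤ (Nat.log 2 n + 1 : ℕ) := by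
      exact_mod_cast Nat.size_le.2 (Nat.lt_pow_succ_log_self one_lt_two n)
    _ ≤ Real.logb 2 n + 1 := by
      push_cast
      gcongr
      exact Real.natLog_le_logb n 2

theorem isBigO_const_log (a : ℝ) :
    (fun _ : ℕ => a) =O[Filter.atTop] (fun n : ℕ => Real.log n) :=
  Real.isLittleO_const_log_atTop.isBigO.comp_tendsto tendsto_natCast_atTop_atTop

theorem isBigO_size_pow (k : ℕ) :
    (fun n : ℕ => ((n ^ k).size : ℝ)) =O[Filter.atTop] (fun n : ℕ => Real.log n) := by
  have hlog : (fun n : ℕ => Real.logb 2 (n ^ k : ℕ) + 1) =O[Filter.atTop]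
      (fun n : ℕ => Real.log n) := by
    refine .add ?_ (isBigO_const_log 1)
    simp only [Nat.cast_pow, Real.logb]
    exact ((Asymptotics.isBigO_refl _ _).const_mul_left (k / Real.log 2)).congr_left
      fun n => by rw [Real.log_pow, div_mul_eq_mul_div]
  refine .trans (.of_bound' (.of_forall fun n => ?_)) hlog
  rw [Real.norm_of_nonneg (Nat.cast_nonneg _)]
  exact (size_le_logb _).trans (le_abs_self _)

end LocalCert

theorem mainTheorem9 (k : ℕ) :
    ∃ f : ℕ → ℕ,
      (fun n : ℕ => (f n : ℝ)) =O[Filter.atTop] (fun n : ℕ => Real.log (n : ℝ)) ∧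
      LocalCert.CertifiableWith k LocalCert.twoConnectedSeriesParallel f := by
  refine ⟨fun n => 35 * (2 * (n ^ (k + 1)).size + 1), ?_,
    LocalCert.certifiableWith_of_encoding LocalCert.Certificate.encode_injective
      (Valid := LocalCert.LocallyValid) ?complete ?sound⟩
  · push_cast
    exact (((LocalCert.isBigO_size_pow (k + 1)).const_mul_left 2).add
      (LocalCert.isBigO_const_log 1)).const_mul_left 35
  case complete =>
    intro V _ G hG ident hident hC
    have hpos : 0 < Fintype.card V := have := hG.nonempty; Fintype.card_pos
    have ident_le (v : V) : ident v ≤ Fintype.card V ^ (k + 1) :=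
      (hident.2 v).2.trans (Nat.pow_le_pow_right hpos k.le_succ)
    obtain ⟨c, hbound, hc⟩ := LocalCert.exists_locallyValid hC.1 hC.2 hident.1 ident_le
      (Nat.le_self_pow k.succ_ne_zero _)
    exact ⟨c, fun v => LocalCert.Certificate.length_encode_le (hbound v), hc⟩
  case sound =>
    exact fun V _ G hG ident hident c hc =>
      LocalCert.isTwoConnected_and_isSeriesParallel hG hident.1 hc
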